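/- Let $\mathcal{G}=(\mathcal{G}^0,\mathcal{G}^1,r,s)$ be a finite directed graph with non-empty vertex set $\mathcal{G}^0$, edge set $\mathcal{G}^1$, range and source maps $r,s:\mathcal{G}^1\to\mathcal{G}^0$, and without loops or multiple edges. Let $\otimes$ be the minimal tensor product of $\mathrm{C}^*$-algebras and $[\,\cdot\,]$ the closed linear span. A compact quantum group $G$ is a non-zero unital $\mathrm{C}^*$-algebra $\mathrm{C}(G)$ with a unital $*$-homomorphism $\Delta_G:\mathrm{C}(G)\to \mathrm{C}(G)\otimes \mathrm{C}(G)$ such that $(\mathrm{id}\otimes\Delta_G)\Delta_G=(\Delta_G\otimes\mathrm{id})\Delta_G$ and $[\Delta_G(\mathrm{C}(G))(1\otimes \mathrm{C}(G))]=[\Delta_G(\mathrm{C}(G))(\mathrm{C}(G)\otimes 1)]=\mathrm{C}(G)\otimes \mathrm{C}(G)$. The space $\mathrm{C}(\mathcal{G}^1)$ is a $\mathrm{C}^*$-correspondence over $\mathrm{C}(\mathcal{G}^0)$ via $(\xi f)(e)=\xi(e)f(r(e))$, $\langle\xi,\eta\rangle(v)=\sum_{r(e)=v}\overline{\xi(e)}\eta(e)$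 and $(\phi(f)\xi)(e)=f(s(e))\xi(e)$; the same formulas give the right action, the inner product and $\phi\otimes\mathrm{id}$ for $\mathrm{C}(\mathcal{G}^1)\otimes \mathrm{C}(G)$ over $\mathrm{C}(\mathcal{G}^0)\otimes \mathrm{C}(G)$. Put $r_*(f)=f\circ r$ for $f\in \mathrm{C}(\mathcal{G}^0)$. The category $\mathcal{C}_{\mathrm{Ban}}(\mathcal{G})$ has as objects the triples $(G,\alpha,\lambda)$ consisting of a compact quantum group $G$, a unital $*$-homomorphism $\alpha:\mathrm{C}(\mathcal{G}^0)\to \mathrm{C}(\mathcal{G}^0)\otimes \mathrm{C}(G)$ and a linear map $\lambda:\mathrm{C}(\mathcal{G}^1)\to \mathrm{C}(\mathcal{G}^1)\otimes \mathrm{C}(G)$ such that 1. $(\alpha\otimes\mathrm{id})\alpha=(\mathrm{id}\otimes\Delta_G)\alpha$ and $[\alpha(\mathrm{C}(\mathcal{G}^0))(1\otimes \mathrm{C}(G))]=\mathrm{C}(\mathcal{G}^0)\otimes \mathrm{C}(G)$, and $\alpha$ is faithful, i.e. the $*$-algebra generated by the elements $(\omega\otimes\mathrm{id})\alpha(f)$,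 with $f\in \mathrm{C}(\mathcal{G}^0)$ and $\omega\in \mathrm{C}(\mathcal{G}^0)^*$, is dense in $\mathrm{C}(G)$; 2. $(\mathrm{C}(\mathcal{G}^1),\phi,\lambda)$ is a $G$-equivariant correspondence over $(\mathrm{C}(\mathcal{G}^0),\alpha)$: $\lambda(\xi f)=\lambda(\xi)\alpha(f)$, $\langle\lambda(\xi),\lambda(\eta)\rangle=\alpha(\langle\xi,\eta\rangle)$, $(\lambda\otimes\mathrm{id})\lambda=(\mathrm{id}\otimes\Delta_G)\lambda$, $[\lambda(\mathrm{C}(\mathcal{G}^1))(1\otimes \mathrm{C}(G))]=\mathrm{C}(\mathcal{G}^1)\otimes \mathrm{C}(G)$, and $\lambda(\phi(f)\xi)=(\phi\otimes\mathrm{id})(\alpha(f))\lambda(\xi)$; 3. $(r_*\otimes\mathrm{id})\alpha(f)=\lambda(r_*(f))$ for all $f\in \mathrm{C}(\mathcal{G}^0)$. A morphism $(G_1,\alpha_1,\lambda_1)\to(G_2,\alpha_2,\lambda_2)$ is a unital $*$-homomorphism $f:\mathrm{C}(G_2)\to \mathrm{C}(G_1)$ with $(f\otimes f)\Delta_{G_2}=\Delta_{G_1}f$,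 $(\mathrm{id}\otimes f)\alpha_2=\alpha_1$ and $(\mathrm{id}\otimes f)\lambda_2=\lambda_1$. Banica's quantum automorphism group $\mathrm{Aut}^+_{\mathrm{Ban}}(\mathcal{G})$ is the compact quantum group whose $\mathrm{C}^*$-algebra is the universal unital $\mathrm{C}^*$-algebra generated by elements $q_{vw}$, $v,w\in\mathcal{G}^0$, subject to $q_{vw}=q_{vw}^*=q_{vw}^2$, $\sum_{w}q_{vw}=\sum_{w}q_{wv}=1$ and $UD=DU$, where $U=(q_{vw})$ and $D$ is the adjacency matrix of $\mathcal{G}$, with comultiplication $\Delta(q_{vw})=\sum_{u}q_{vu}\otimes q_{uw}$. **Theorem.** The category $\mathcal{C}_{\mathrm{Ban}}(\mathcal{G})$ has a universal object $(G_{\mathrm{Ban}},\alpha_{\mathrm{Ban}},\lambda_{\mathrm{Ban}})$: every object admits exactly one morphism to it. Moreover, $\mathrm{Aut}^+_{\mathrm{Ban}}(\mathcal{G})$ exists, and $G_{\mathrm{Ban}}$ is isomorphic to it as a compact quantum group. -/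

import Mathlib

namespace CStarTensor

open scoped ComplexOrder TensorProduct ComplexConjugate

section Functionals

theorem conj_symm_of_nonneg {T : Type*} [AddCommGroup T] [Module ℂ T] (s : T → T → ℂ)
    (add_l : ∀ x y z, s (x + y) z = s x z + s y z) (add_r : ∀ x y z, s x (y + z) = s x y + s x z)
    (smul_l : ∀ (c : ℂ) x y, s (c • x) y = conj c * s x y)
    (smul_r : ∀ (c : ℂ) x y, s x (c • y) = c * s x y)
    (h : ∀ x, 0 ≤ s x x) (x y : T) : conj (s y x) = s x y := by
  have key : ∀ z, (s z z).im = 0 := fun z => (Complex.nonneg_iff.1 (h z)).2.symm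
  have h1 := key (x + y)
  have h2 := key (x + Complex.I • y)
  simp only [add_l, add_r, smul_l, smul_r, Complex.add_im, key, Complex.conj_I, Complex.mul_im,
    Complex.mul_re, Complex.neg_re, Complex.neg_im, Complex.I_re, Complex.I_im] at h1 h2
  apply Complex.ext
  · simp only [Complex.conj_re]; linarith
  · simp only [Complex.conj_im]; linarith

variable {A B C D : Type*} [CStarAlgebra A] [CStarAlgebra B] [CStarAlgebra C] [CStarAlgebra D]

/-- A matrix `(φ i j)` of functionals on `A` is positive if `∑ φ i j (aᵢ⋆ aⱼ) ≥ 0` for all `a`;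
equivalently `φ i j x = ⟪ξᵢ, π x ξⱼ⟫` for a representation `π` of `A` and vectors `ξᵢ`. -/
def IsPosKernel {ι : Type} [Fintype ι] (φ : ι → ι → A →ₗ[ℂ] ℂ) : Prop :=
  ∀ a : ι → A, 0 ≤ ∑ i, ∑ j, φ i j (star (a i) * a j)

/-- The functional `∑ φ i j ⊗ ψ i j` on the algebraic tensor product. -/
noncomputable def kernelFunctional {ι : Type} [Fintype ι] (φ : ι → ι → A →ₗ[ℂ] ℂ)
    (ψ : ι → ι → B →ₗ[ℂ] ℂ) : A ⊗[ℂ] B →ₗ[ℂ] ℂ :=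
  ∑ i, ∑ j, LinearMap.mul' ℂ ℂ ∘ₗ TensorProduct.map (φ i j) (ψ i j)

/-- The functionals `t ↦ ⟪η, (π ⊗ ρ)(t) η⟫` on the algebraic tensor product, where `π`, `ρ` are
representations of `A`, `B` on Hilbert spaces `H`, `K` and `η = ∑ ξᵢ ⊗ ζᵢ` is a vector of the
algebraic tensor product of `H` and `K`. -/
def IsVectorFunctional (Ω : A ⊗[ℂ] B →ₗ[ℂ] ℂ) : Prop :=
  ∃ (ι : Type) (_ : Fintype ι) (φ : ι → ι → A →ₗ[ℂ] ℂ) (ψ : ι → ι → B →ₗ[ℂ] ℂ),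
    IsPosKernel φ ∧ IsPosKernel ψ ∧ Ω = kernelFunctional φ ψ

theorem kernelFunctional_tmul {ι : Type} [Fintype ι] (φ : ι → ι → A →ₗ[ℂ] ℂ)
    (ψ : ι → ι → B →ₗ[ℂ] ℂ) (a : A) (b : B) :
    kernelFunctional φ ψ (a ⊗ₜ b) = ∑ i, ∑ j, φ i j a * ψ i j b := by
  simp [kernelFunctional, LinearMap.sum_apply]

theorem IsPosKernel.comp_mul {ι κ : Type} [Fintype ι] [Fintype κ] {φ : ι → ι → A →ₗ[ℂ] ℂ}
    (hφ : IsPosKernel φ) (c : κ → A) :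
    IsPosKernel (fun p q : ι × κ => φ p.1 q.1 ∘ₗ LinearMap.mulLeft ℂ (star (c p.2)) ∘ₗ
      LinearMap.mulRight ℂ (c q.2)) := by
  intro a
  have := hφ (fun i => ∑ k, a (i, k) * c k)
  simp only [star_sum, Finset.sum_mul, Finset.mul_sum, map_sum, star_mul] at this
  simp only [Fintype.sum_prod_type, LinearMap.comp_apply, LinearMap.mulLeft_apply,
    LinearMap.mulRight_apply]
  refine this.trans_eq (Finset.sum_congr rfl fun i _ => ?_)
  rw [Finset.sum_comm (s := (Finset.univ : Finset κ))]
  refine Finset.sum_congr rfl fun j _ => ?_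
  rw [Finset.sum_comm]
  simp only [mul_assoc]

theorem IsPosKernel.posSemidef {ι κ : Type} [Fintype ι] [Fintype κ] {φ : ι → ι → A →ₗ[ℂ] ℂ}
    (hφ : IsPosKernel φ) (a : κ → A) :
    (Matrix.of fun p q : ι × κ => φ p.1 q.1 (star (a p.2) * a q.2)).PosSemidef := by
  set M : Matrix (ι × κ) (ι × κ) ℂ := Matrix.of fun p q => φ p.1 q.1 (star (a p.2) * a q.2)
  have key : ∀ x, 0 ≤ star x ⬝ᵥ (M.mulVec x) := by
    intro x
    have := hφ.comp_mul a (fun p => algebraMap ℂ A (x p))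
    refine this.trans_eq ?_
    simp only [dotProduct, Matrix.mulVec, Finset.mul_sum]
    refine Finset.sum_congr rfl fun p _ => Finset.sum_congr rfl fun q _ => ?_
    have : star (a p.2) * (star (algebraMap ℂ A (x p)) * algebraMap ℂ A (x q) * a q.2)
        = (star (x p) * x q) • (star (a p.2) * a q.2) := by
      simp [Algebra.algebraMap_eq_smul_one, smul_smul, mul_comm]
    simp only [LinearMap.comp_apply, LinearMap.mulLeft_apply, LinearMap.mulRight_apply, this,
      map_smul, smul_eq_mul, M, Matrix.of_apply, Pi.star_apply]
    ring
  refine .of_dotProduct_mulVec_nonneg ?_ key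
  have := conj_symm_of_nonneg (fun x y => star x ⬝ᵥ (M.mulVec y))
    (by intros; simp [add_dotProduct]) (by intros; simp [Matrix.mulVec_add, dotProduct_add])
    (by intros; simp) (by intros; simp [Matrix.mulVec_smul]) key
  classical
  ext p q
  have h := this (Pi.single p 1) (Pi.single q 1)
  simpa [Pi.star_single] using h

theorem exists_sum_tmul (t : A ⊗[ℂ] B) :
    ∃ (n : ℕ) (a : Fin n → A) (b : Fin n → B), t = ∑ k, a k ⊗ₜ[ℂ] b k := by
  obtain ⟨S, hS⟩ := TensorProduct.exists_finset t
  refine ⟨S.card, fun k => (S.equivFin.symm k).1.1, fun k => (S.equivFin.symm k).1.2, ?_⟩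
  rw [hS, ← Finset.sum_coe_sort, ← S.equivFin.symm.sum_comp]

theorem sum_reorder {ι κ : Type} [Fintype ι] [Fintype κ] (F : ι → ι → κ → κ → ℂ) :
    ∑ l, ∑ k, ∑ i, ∑ j, F i j k l = ∑ i, ∑ k, ∑ j, ∑ l, F i j k l := by
  calc ∑ l, ∑ k, ∑ i, ∑ j, F i j k l = ∑ l, ∑ i, ∑ k, ∑ j, F i j k l :=
        Finset.sum_congr rfl fun l _ => Finset.sum_comm
    _ = ∑ i, ∑ l, ∑ k, ∑ j, F i j k l := Finset.sum_comm
    _ = ∑ i, ∑ k, ∑ l, ∑ j, F i j k l := Finset.sum_congr rfl fun i _ => Finset.sum_comm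
    _ = ∑ i, ∑ k, ∑ j, ∑ l, F i j k l :=
        Finset.sum_congr rfl fun i _ => Finset.sum_congr rfl fun k _ => Finset.sum_comm

theorem IsVectorFunctional.nonneg {Ω : A ⊗[ℂ] B →ₗ[ℂ] ℂ} (h : IsVectorFunctional Ω)
    (t : A ⊗[ℂ] B) : 0 ≤ Ω (star t * t) := by
  obtain ⟨ι, _, φ, ψ, hφ, hψ, rfl⟩ := h
  obtain ⟨n, a, b, rfl⟩ := exists_sum_tmul t
  have := ((hφ.posSemidef a).hadamard (hψ.posSemidef b)).dotProduct_mulVec_nonneg (fun _ => 1)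
  refine this.trans_eq ?_
  simp only [star_sum, Finset.sum_mul, Finset.mul_sum, map_sum, TensorProduct.star_tmul,
    Algebra.TensorProduct.tmul_mul_tmul, kernelFunctional_tmul, dotProduct, Matrix.mulVec,
    Matrix.hadamard_apply, Matrix.of_apply, Pi.star_apply, star_one, one_mul, mul_one,
    Fintype.sum_prod_type]
  exact (sum_reorder fun i j k l => φ i j (star (a k) * a l) * ψ i j (star (b k) * b l)).symm

theorem IsVectorFunctional.conj {Ω : A ⊗[ℂ] B →ₗ[ℂ] ℂ} (h : IsVectorFunctional Ω)
    (y : A ⊗[ℂ] B) : IsVectorFunctional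
      (Ω ∘ₗ LinearMap.mulLeft ℂ (star y) ∘ₗ LinearMap.mulRight ℂ y) := by
  obtain ⟨ι, _, φ, ψ, hφ, hψ, rfl⟩ := h
  obtain ⟨n, a, b, rfl⟩ := exists_sum_tmul y
  refine ⟨ι × Fin n, inferInstance, _, _, hφ.comp_mul a, hψ.comp_mul b, ?_⟩
  ext u v
  simp [kernelFunctional_tmul, Fintype.sum_prod_type, Finset.sum_mul, Finset.mul_sum, star_sum]
  exact sum_reorder fun i j k l =>
    φ i j (star (a k) * (u * a l)) * ψ i j (star (b k) * (v * b l))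

theorem IsPosKernel.smul {ι : Type} [Fintype ι] {φ : ι → ι → A →ₗ[ℂ] ℂ}
    (hφ : IsPosKernel φ) {c : ℝ} (hc : 0 ≤ c) : IsPosKernel (fun i j => (c : ℂ) • φ i j) := by
  intro a
  have := mul_nonneg (Complex.zero_le_real.2 hc) (hφ a)
  simpa [Finset.mul_sum] using this

theorem IsVectorFunctional.smul {Ω : A ⊗[ℂ] B →ₗ[ℂ] ℂ} (h : IsVectorFunctional Ω)
    {c : ℝ} (hc : 0 ≤ c) : IsVectorFunctional ((c : ℂ) • Ω) := by
  obtain ⟨ι, _, φ, ψ, hφ, hψ, rfl⟩ := h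
  refine ⟨ι, inferInstance, _, ψ, hφ.smul hc, hψ, ?_⟩
  ext u v
  simp [kernelFunctional_tmul, Finset.mul_sum, mul_assoc]

theorem IsPosKernel.comp {ι : Type} [Fintype ι] {φ : ι → ι → A →ₗ[ℂ] ℂ}
    (hφ : IsPosKernel φ) (f : C →⋆ₐ[ℂ] A) :
    IsPosKernel (fun i j => φ i j ∘ₗ f.toAlgHom.toLinearMap) := by
  intro a
  have := hφ (fun i => f (a i))
  simpa [map_star] using this

theorem IsVectorFunctional.comp {Ω : A ⊗[ℂ] B →ₗ[ℂ] ℂ} (h : IsVectorFunctional Ω)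
    (f : C →⋆ₐ[ℂ] A) (g : D →⋆ₐ[ℂ] B) :
    IsVectorFunctional (Ω ∘ₗ TensorProduct.map f.toAlgHom.toLinearMap g.toAlgHom.toLinearMap) := by
  obtain ⟨ι, _, φ, ψ, hφ, hψ, rfl⟩ := h
  refine ⟨ι, inferInstance, _, _, hφ.comp f, hψ.comp g, ?_⟩
  ext u v
  simp [kernelFunctional_tmul]


theorem IsVectorFunctional.symm {Ω : A ⊗[ℂ] B →ₗ[ℂ] ℂ} (h : IsVectorFunctional Ω)
    (x y : A ⊗[ℂ] B) : (starRingEnd ℂ) (Ω (star y * x)) = Ω (star x * y) :=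
  conj_symm_of_nonneg (fun x y => Ω (star x * y)) (by intros; simp [add_mul])
    (by intros; simp [mul_add]) (by intros; simp) (by intros; simp) h.nonneg x y

/-- The semi-inner product `Ω(x⋆ y)`. -/
@[reducible] noncomputable def IsVectorFunctional.core {Ω : A ⊗[ℂ] B →ₗ[ℂ] ℂ} (h : IsVectorFunctional Ω) :
    PreInnerProductSpace.Core ℂ (A ⊗[ℂ] B) where
  inner x y := Ω (star x * y)
  conj_inner_symm x y := h.symm x y
  re_inner_nonneg x := (Complex.nonneg_iff.1 (h.nonneg x)).1
  add_left x y z := by simp [add_mul]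
  smul_left x y c := by simp

/-- The seminorm `√Ω(t⋆ t)`, that is, `‖(π ⊗ ρ)(t) η‖` for the vector functional `Ω` of `η`. -/
noncomputable def vnorm (Ω : A ⊗[ℂ] B →ₗ[ℂ] ℂ) (t : A ⊗[ℂ] B) : ℝ := √(Ω (star t * t)).re

theorem IsVectorFunctional.vnorm_sq {Ω : A ⊗[ℂ] B →ₗ[ℂ] ℂ} (h : IsVectorFunctional Ω)
    (t : A ⊗[ℂ] B) : vnorm Ω t ^ 2 = (Ω (star t * t)).re :=
  Real.sq_sqrt (Complex.nonneg_iff.1 (h.nonneg t)).1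

theorem IsVectorFunctional.vnorm_add {Ω : A ⊗[ℂ] B →ₗ[ℂ] ℂ} (h : IsVectorFunctional Ω)
    (s t : A ⊗[ℂ] B) : vnorm Ω (s + t) ≤ vnorm Ω s + vnorm Ω t :=
  @norm_add_le _ (@InnerProductSpace.Core.toSeminormedAddCommGroup ℂ _ _ _ _
    h.core).toSeminormedAddGroup s t

theorem IsVectorFunctional.cauchy {Ω : A ⊗[ℂ] B →ₗ[ℂ] ℂ} (h : IsVectorFunctional Ω)
    (s t : A ⊗[ℂ] B) : ‖Ω (star s * t)‖ ≤ vnorm Ω s * vnorm Ω t :=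
  @InnerProductSpace.Core.norm_inner_le_norm ℂ _ _ _ _ h.core s t

theorem vnorm_smul (Ω : A ⊗[ℂ] B →ₗ[ℂ] ℂ) (c : ℂ) (t : A ⊗[ℂ] B) :
    vnorm Ω (c • t) = ‖c‖ * vnorm Ω t := by
  have : Ω (star (c • t) * (c • t)) = ((‖c‖ ^ 2 : ℝ) : ℂ) * Ω (star t * t) := by
    simp only [star_smul, smul_mul_assoc, mul_smul_comm, map_smul, smul_eq_mul, ← mul_assoc]
    congr 1
    rw [RCLike.star_def, Complex.mul_conj']
    simp
  rw [vnorm, this, Complex.re_ofReal_mul, Real.sqrt_mul (by positivity),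
    Real.sqrt_sq (norm_nonneg _), vnorm]

theorem exists_norm_sq_sub (a : A) : ∃ c : A, star c * c = ((‖a‖ ^ 2 : ℝ) : ℂ) • 1 - star a * a := by
  let _ := CStarAlgebra.spectralOrder A
  have := CStarAlgebra.spectralOrderedRing A
  have h : star a * a ≤ algebraMap ℝ A (‖a‖ ^ 2) := CStarAlgebra.star_mul_le_algebraMap_norm_sq
  obtain ⟨c, hc⟩ := CStarAlgebra.nonneg_iff_eq_star_mul_self.1 (sub_nonneg.2 h)
  refine ⟨c, hc.symm.trans ?_⟩
  rw [Algebra.algebraMap_eq_smul_one]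
  congr 1

theorem IsVectorFunctional.vnorm_tmul_le {Ω : A ⊗[ℂ] B →ₗ[ℂ] ℂ} (h : IsVectorFunctional Ω)
    (h1 : (Ω 1).re ≤ 1) (a : A) (b : B) : vnorm Ω (a ⊗ₜ b) ≤ ‖a‖ * ‖b‖ := by
  obtain ⟨c, hc⟩ := exists_norm_sq_sub a
  obtain ⟨d, hd⟩ := exists_norm_sq_sub b
  have e1 := (Complex.nonneg_iff.1 (h.nonneg (c ⊗ₜ b))).1
  have e2 := (Complex.nonneg_iff.1 (h.nonneg (1 ⊗ₜ d))).1
  have e3 := (Complex.nonneg_iff.1 (h.nonneg 1)).1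
  have l1 : (Ω (star (c ⊗ₜ[ℂ] b) * (c ⊗ₜ[ℂ] b))) =
      ((‖a‖ ^ 2 : ℝ) : ℂ) * Ω (1 ⊗ₜ (star b * b)) - Ω ((star a * a) ⊗ₜ (star b * b)) := by
    rw [TensorProduct.star_tmul, Algebra.TensorProduct.tmul_mul_tmul, hc, TensorProduct.sub_tmul,
      map_sub, ← TensorProduct.smul_tmul', map_smul, smul_eq_mul]
  have l2 : (Ω (star (1 ⊗ₜ[ℂ] d) * ((1 : A) ⊗ₜ[ℂ] d))) =
      ((‖b‖ ^ 2 : ℝ) : ℂ) * Ω 1 - Ω (1 ⊗ₜ (star b * b)) := by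
    rw [TensorProduct.star_tmul, Algebra.TensorProduct.tmul_mul_tmul, hd, TensorProduct.tmul_sub,
      map_sub, TensorProduct.tmul_smul, map_smul, smul_eq_mul, star_one, one_mul,
      Algebra.TensorProduct.one_def]
  rw [l1, Complex.sub_re, Complex.re_ofReal_mul] at e1
  rw [l2, Complex.sub_re, Complex.re_ofReal_mul] at e2
  rw [vnorm]
  apply Real.sqrt_le_iff.2 ⟨by positivity, ?_⟩
  rw [TensorProduct.star_tmul, Algebra.TensorProduct.tmul_mul_tmul]
  have := mul_le_mul_of_nonneg_left e2 (sq_nonneg ‖a‖)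
  have h4 : ‖a‖ ^ 2 * ‖b‖ ^ 2 * (Ω 1).re ≤ ‖a‖ ^ 2 * ‖b‖ ^ 2 * 1 :=
    mul_le_mul_of_nonneg_left h1 (by positivity)
  nlinarith

/-- The minimal (spatial) C⋆-seminorm `‖t‖ = sup ‖(π ⊗ ρ)(t)‖` over all representations `π` of `A`
and `ρ` of `B`, written as the supremum of `‖(π ⊗ ρ)(t) η‖` over the vectors `η` of norm at most one
in the algebraic tensor product of the two Hilbert spaces. -/
noncomputable def minNorm (t : A ⊗[ℂ] B) : ℝ :=
  sSup {r : ℝ | ∃ Ω : A ⊗[ℂ] B →ₗ[ℂ] ℂ, IsVectorFunctional Ω ∧ (Ω 1).re ≤ 1 ∧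
    r = √(Ω (star t * t)).re}

theorem minNorm_bddAbove (t : A ⊗[ℂ] B) :
    BddAbove {r : ℝ | ∃ Ω : A ⊗[ℂ] B →ₗ[ℂ] ℂ, IsVectorFunctional Ω ∧ (Ω 1).re ≤ 1 ∧
      r = √(Ω (star t * t)).re} := by
  obtain ⟨n, a, b, rfl⟩ := exists_sum_tmul t
  refine ⟨∑ k, ‖a k‖ * ‖b k‖, ?_⟩
  rintro r ⟨Ω, h, h1, rfl⟩
  change vnorm Ω _ ≤ _
  have : ∀ S : Finset (Fin n), vnorm Ω (∑ k ∈ S, a k ⊗ₜ[ℂ] b k) ≤ ∑ k ∈ S, ‖a k‖ * ‖b k‖ := by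
    intro S
    induction S using Finset.cons_induction with
    | empty => simp [vnorm]
    | cons k S hk ih =>
      rw [Finset.sum_cons, Finset.sum_cons]
      exact (h.vnorm_add _ _).trans (add_le_add (h.vnorm_tmul_le h1 _ _) ih)
  exact this _

theorem vnorm_le {Ω : A ⊗[ℂ] B →ₗ[ℂ] ℂ} (h : IsVectorFunctional Ω) (h1 : (Ω 1).re ≤ 1)
    (t : A ⊗[ℂ] B) : vnorm Ω t ≤ minNorm t :=
  le_csSup (minNorm_bddAbove t) ⟨Ω, h, h1, rfl⟩

theorem minNorm_nonneg (t : A ⊗[ℂ] B) : 0 ≤ minNorm t :=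
  Real.sSup_nonneg (by rintro r ⟨Ω, _, _, rfl⟩; exact Real.sqrt_nonneg _)

theorem minNorm_le {t : A ⊗[ℂ] B} {c : ℝ} (hc : 0 ≤ c)
    (H : ∀ Ω : A ⊗[ℂ] B →ₗ[ℂ] ℂ, IsVectorFunctional Ω → (Ω 1).re ≤ 1 → vnorm Ω t ≤ c) :
    minNorm t ≤ c :=
  Real.sSup_le (by rintro r ⟨Ω, h, h1, rfl⟩; exact H Ω h h1) hc

theorem minNorm_add (s t : A ⊗[ℂ] B) : minNorm (s + t) ≤ minNorm s + minNorm t :=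
  minNorm_le (add_nonneg (minNorm_nonneg _) (minNorm_nonneg _)) fun _ h h1 =>
    (h.vnorm_add s t).trans (add_le_add (vnorm_le h h1 s) (vnorm_le h h1 t))

theorem minNorm_smul_le (c : ℂ) (t : A ⊗[ℂ] B) : minNorm (c • t) ≤ ‖c‖ * minNorm t :=
  minNorm_le (mul_nonneg (norm_nonneg _) (minNorm_nonneg _)) fun Ω h h1 =>
    (vnorm_smul Ω c t).trans_le (mul_le_mul_of_nonneg_left (vnorm_le h h1 t) (norm_nonneg _))

theorem IsVectorFunctional.vnorm_le_minNorm_mul {Ω : A ⊗[ℂ] B →ₗ[ℂ] ℂ}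
    (h : IsVectorFunctional Ω) (t : A ⊗[ℂ] B) {c : ℝ} (hc : 0 ≤ c) (h1 : (Ω 1).re ≤ c ^ 2) :
    vnorm Ω t ≤ minNorm t * c := by
  have key : ∀ δ : ℝ, 0 < δ → vnorm Ω t ≤ minNorm t * (c + δ) := by
    intro δ hδ
    have hp : 0 < c + δ := by positivity
    have hi : 0 ≤ ((c + δ) ^ 2)⁻¹ := by positivity
    have h2 : ((((((c + δ) ^ 2)⁻¹ : ℝ) : ℂ) • Ω) 1).re ≤ 1 := by
      rw [LinearMap.smul_apply, smul_eq_mul, Complex.re_ofReal_mul, inv_mul_le_iff₀ (by positivity)]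
      nlinarith
    have h3 := vnorm_le (h.smul hi) h2 t
    rw [vnorm, LinearMap.smul_apply, smul_eq_mul, Complex.re_ofReal_mul, Real.sqrt_mul hi,
      Real.sqrt_inv, Real.sqrt_sq hp.le, ← vnorm, inv_mul_le_iff₀ hp] at h3
    linarith
  refine le_of_forall_pos_le_add fun ε hε => ?_
  have hN := minNorm_nonneg t
  refine (key (ε / (minNorm t + 1)) (by positivity)).trans ?_
  have : minNorm t * (ε / (minNorm t + 1)) ≤ ε := by
    rw [← mul_div_assoc, div_le_iff₀ (by positivity)]
    nlinarith
  linarith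

theorem minNorm_mul (s t : A ⊗[ℂ] B) : minNorm (s * t) ≤ minNorm s * minNorm t := by
  refine minNorm_le (mul_nonneg (minNorm_nonneg _) (minNorm_nonneg _)) fun Ω h h1 => ?_
  have h2 := (h.conj t).vnorm_le_minNorm_mul s (minNorm_nonneg t) (by
    have := (pow_le_pow_left₀ (Real.sqrt_nonneg _) (vnorm_le h h1 t) 2)
    rw [← vnorm, h.vnorm_sq] at this
    simpa using this)
  refine le_trans (le_of_eq ?_) h2
  simp [vnorm, mul_assoc]

theorem minNorm_sq_le (t : A ⊗[ℂ] B) : minNorm t * minNorm t ≤ minNorm (star t * t) := by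
  have : minNorm t ≤ √(minNorm (star t * t)) := minNorm_le (Real.sqrt_nonneg _) fun Ω h h1 => by
    refine Real.le_sqrt_of_sq_le ?_
    rw [h.vnorm_sq]
    refine (Complex.re_le_norm _).trans ?_
    have hc := h.cauchy 1 (star t * t)
    rw [star_one, one_mul] at hc
    have h3 : vnorm Ω 1 ≤ 1 := Real.sqrt_le_one.2 (by simpa using h1)
    calc _ ≤ _ := hc
      _ ≤ 1 * minNorm (star t * t) :=
        mul_le_mul h3 (vnorm_le h h1 _) (Real.sqrt_nonneg _) zero_le_one
      _ = _ := one_mul _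
  calc _ ≤ √(minNorm (star t * t)) * √(minNorm (star t * t)) :=
        mul_self_le_mul_self (minNorm_nonneg t) this
    _ = _ := Real.mul_self_sqrt (minNorm_nonneg _)

theorem star_map (f : C →⋆ₐ[ℂ] A) (g : D →⋆ₐ[ℂ] B) (t : C ⊗[ℂ] D) :
    Algebra.TensorProduct.map f.toAlgHom g.toAlgHom (star t) =
      star (Algebra.TensorProduct.map f.toAlgHom g.toAlgHom t) := by
  induction t with
  | zero => simp
  | add x y hx hy => simp only [star_add, map_add, hx, hy]
  | tmul x y => simp [map_star]

theorem minNorm_map_le (f : C →⋆ₐ[ℂ] A) (g : D →⋆ₐ[ℂ] B) (t : C ⊗[ℂ] D) :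
    minNorm (Algebra.TensorProduct.map f.toAlgHom g.toAlgHom t) ≤ minNorm t := by
  refine minNorm_le (minNorm_nonneg _) fun Ω h h1 => ?_
  refine le_trans (le_of_eq ?_) (vnorm_le (h.comp f g) ?_ t)
  · rw [vnorm, vnorm, ← star_map, ← map_mul]
    rfl
  · refine le_trans (le_of_eq ?_) h1
    rw [LinearMap.comp_apply, Algebra.TensorProduct.one_def, TensorProduct.map_tmul]
    simp [Algebra.TensorProduct.one_def]

theorem minNorm_one_le : minNorm (1 : A ⊗[ℂ] B) ≤ 1 :=
  minNorm_le zero_le_one fun Ω h h1 => Real.sqrt_le_one.2 (by simpa using h1)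

theorem minNorm_zero : minNorm (0 : A ⊗[ℂ] B) = 0 :=
  le_antisymm (by have := minNorm_smul_le 0 (0 : A ⊗[ℂ] B); rwa [zero_smul, norm_zero, zero_mul] at this)
    (minNorm_nonneg _)

theorem minNorm_neg (t : A ⊗[ℂ] B) : minNorm (-t) = minNorm t := by
  have h : ∀ s : A ⊗[ℂ] B, minNorm (-s) ≤ minNorm s := fun s => by
    have := minNorm_smul_le (-1) s
    rwa [neg_smul, one_smul, norm_neg, norm_one, one_mul] at this
  exact le_antisymm (h t) (by simpa using h (-t))

end Functionals

section Completion

variable (A B : Type*) [CStarAlgebra A] [CStarAlgebra B]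

/-- The algebraic tensor product, to be normed with the minimal C⋆-norm. -/
def AlgTensor : Type _ := A ⊗[ℂ] B

noncomputable instance : Ring (AlgTensor A B) := inferInstanceAs (Ring (A ⊗[ℂ] B))
noncomputable instance : Algebra ℂ (AlgTensor A B) := inferInstanceAs (Algebra ℂ (A ⊗[ℂ] B))
noncomputable instance : StarRing (AlgTensor A B) := inferInstanceAs (StarRing (A ⊗[ℂ] B))
instance : StarModule ℂ (AlgTensor A B) := inferInstanceAs (StarModule ℂ (A ⊗[ℂ] B))

/-- The minimal norm as a ring seminorm. -/
noncomputable def minRingSeminorm : RingSeminorm (AlgTensor A B) where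
  toFun := minNorm (A := A) (B := B)
  map_zero' := minNorm_zero
  add_le' := minNorm_add
  neg' := minNorm_neg
  mul_le' := minNorm_mul

noncomputable instance : SeminormedRing (AlgTensor A B) where
  __ := (minRingSeminorm A B).toAddGroupSeminorm.toSeminormedAddCommGroup
  __ := (inferInstance : Ring (AlgTensor A B))
  norm_mul_le := minNorm_mul

noncomputable instance : NormedAlgebra ℂ (AlgTensor A B) where
  norm_smul_le := minNorm_smul_le

theorem norm_star_mul_self_ge (t : AlgTensor A B) : ‖t‖ * ‖t‖ ≤ ‖star t * t‖ := minNorm_sq_le t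

instance : NormedStarGroup (AlgTensor A B) where
  norm_star_le t := by
    rcases (norm_nonneg (star t)).eq_or_lt with h | h
    · rw [← h]; exact norm_nonneg _
    · have := (norm_star_mul_self_ge A B (star t)).trans (norm_mul_le _ _)
      rw [star_star, mul_comm ‖t‖] at this
      exact le_of_mul_le_mul_left this h

/-- The minimal tensor product `A ⊗ B` of unital C⋆-algebras. -/
def MinTensor : Type _ := UniformSpace.Completion (AlgTensor A B)

noncomputable instance : NormedRing (MinTensor A B) :=
  inferInstanceAs (NormedRing (UniformSpace.Completion (AlgTensor A B)))
noncomputable instance : CompleteSpace (MinTensor A B) :=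
  inferInstanceAs (CompleteSpace (UniformSpace.Completion (AlgTensor A B)))
noncomputable instance : Algebra ℂ (MinTensor A B) :=
  inferInstanceAs (Algebra ℂ (UniformSpace.Completion (AlgTensor A B)))
noncomputable instance : NormedAlgebra ℂ (MinTensor A B) where
  norm_smul_le := norm_smul_le (α := ℂ) (β := UniformSpace.Completion (AlgTensor A B))

variable {A B}

/-- The canonical map of the algebraic into the minimal tensor product. -/
noncomputable def incl : AlgTensor A B →ₐ[ℂ] MinTensor A B where
  toFun t := (t : UniformSpace.Completion (AlgTensor A B))
  map_one' := UniformSpace.Completion.coe_one _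
  map_zero' := UniformSpace.Completion.coe_zero
  map_mul' := UniformSpace.Completion.coe_mul
  map_add' := UniformSpace.Completion.coe_add
  commutes' _ := rfl

theorem norm_incl (t : AlgTensor A B) : ‖incl t‖ = ‖t‖ := UniformSpace.Completion.norm_coe t

theorem continuous_incl : Continuous (incl : AlgTensor A B → MinTensor A B) :=
  UniformSpace.Completion.continuous_coe _

theorem denseRange_incl : DenseRange (incl : AlgTensor A B → MinTensor A B) :=
  UniformSpace.Completion.denseRange_coe

noncomputable instance : Star (MinTensor A B) where
  star := UniformSpace.Completion.map (star : AlgTensor A B → AlgTensor A B)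

theorem continuous_star' : Continuous (star : MinTensor A B → MinTensor A B) :=
  UniformSpace.Completion.continuous_map

theorem star_incl (t : AlgTensor A B) : star (incl t) = incl (star t) :=
  UniformSpace.Completion.map_coe star_isometry.uniformContinuous t

noncomputable instance : StarRing (MinTensor A B) where
  star_involutive x := by
    refine denseRange_incl.induction_on (p := fun x => star (star x) = x) x
      (isClosed_eq (continuous_star'.comp continuous_star') continuous_id) fun t => ?_
    rw [star_incl, star_incl, star_star]
  star_mul x y := by
    refine denseRange_incl.induction_on₂ (p := fun x y => star (x * y) = star y * star x)
      (isClosed_eq (continuous_star'.comp continuous_mul)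
        ((continuous_star'.comp continuous_snd).mul (continuous_star'.comp continuous_fst)))
      (fun s t => ?_) x y
    rw [← map_mul, star_incl, star_incl, star_incl, star_mul, map_mul]
  star_add x y := by
    refine denseRange_incl.induction_on₂ (p := fun x y => star (x + y) = star x + star y)
      (isClosed_eq (continuous_star'.comp continuous_add)
        ((continuous_star'.comp continuous_fst).add (continuous_star'.comp continuous_snd)))
      (fun s t => ?_) x y
    rw [← map_add, star_incl, star_incl, star_incl, star_add, map_add]

instance : StarModule ℂ (MinTensor A B) where
  star_smul c x := by
    refine denseRange_incl.induction_on (p := fun x => star (c • x) = star c • star x) x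
      (isClosed_eq (continuous_star'.comp (continuous_const_smul c))
        (continuous_star'.const_smul (star c))) fun t => ?_
    rw [← map_smul, star_incl, star_incl, star_smul, map_smul]

instance : CStarRing (MinTensor A B) where
  norm_mul_self_le x := by
    refine denseRange_incl.induction_on (p := fun x => ‖x‖ * ‖x‖ ≤ ‖star x * x‖) x
      (isClosed_le (continuous_norm.mul continuous_norm)
        (continuous_norm.comp (continuous_star'.mul continuous_id))) fun t => ?_
    rw [star_incl, ← map_mul, norm_incl, norm_incl]
    exact norm_star_mul_self_ge A B t

noncomputable instance : CStarAlgebra (MinTensor A B) where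

/-- The elementary tensor `a ⊗ b` in the minimal tensor product. -/
noncomputable def tmul (a : A) (b : B) : MinTensor A B := incl (a ⊗ₜ[ℂ] b : A ⊗[ℂ] B)

variable {C D : Type*} [CStarAlgebra C] [CStarAlgebra D]

/-- `f ⊗ g` on the algebraic tensor product. -/
noncomputable def algMap (f : C →⋆ₐ[ℂ] A) (g : D →⋆ₐ[ℂ] B) : AlgTensor C D →ₐ[ℂ] AlgTensor A B :=
  Algebra.TensorProduct.map f.toAlgHom g.toAlgHom

theorem norm_algMap_le (f : C →⋆ₐ[ℂ] A) (g : D →⋆ₐ[ℂ] B) (t : AlgTensor C D) :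
    ‖algMap f g t‖ ≤ ‖t‖ := minNorm_map_le f g t

theorem uniformContinuous_algMap (f : C →⋆ₐ[ℂ] A) (g : D →⋆ₐ[ℂ] B) :
    UniformContinuous (algMap f g) :=
  (AddMonoidHomClass.lipschitz_of_bound (algMap f g) 1
    (fun t => by simpa using norm_algMap_le f g t)).uniformContinuous

/-- The continuous extension of `f ⊗ g`. -/
noncomputable def mapFun (f : C →⋆ₐ[ℂ] A) (g : D →⋆ₐ[ℂ] B) : MinTensor C D → MinTensor A B :=
  UniformSpace.Completion.map (algMap f g)

theorem continuous_mapFun (f : C →⋆ₐ[ℂ] A) (g : D →⋆ₐ[ℂ] B) : Continuous (mapFun f g) :=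
  UniformSpace.Completion.continuous_map

theorem mapFun_incl (f : C →⋆ₐ[ℂ] A) (g : D →⋆ₐ[ℂ] B) (t : AlgTensor C D) :
    mapFun f g (incl t) = incl (algMap f g t) :=
  UniformSpace.Completion.map_coe (uniformContinuous_algMap f g) t

/-- The ⋆-homomorphism `f ⊗ g` between minimal tensor products. -/
noncomputable def map (f : C →⋆ₐ[ℂ] A) (g : D →⋆ₐ[ℂ] B) : MinTensor C D →⋆ₐ[ℂ] MinTensor A B where
  toFun := mapFun f g
  map_one' := by rw [← map_one incl, mapFun_incl, map_one, map_one]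
  map_zero' := by rw [← map_zero incl, mapFun_incl, map_zero, map_zero]
  map_mul' x y := by
    refine denseRange_incl.induction_on₂
      (p := fun x y => mapFun f g (x * y) = mapFun f g x * mapFun f g y)
      (isClosed_eq ((continuous_mapFun f g).comp continuous_mul)
        (((continuous_mapFun f g).comp continuous_fst).mul
          ((continuous_mapFun f g).comp continuous_snd))) (fun s t => ?_) x y
    rw [← map_mul, mapFun_incl, mapFun_incl, mapFun_incl, map_mul, map_mul]
  map_add' x y := by
    refine denseRange_incl.induction_on₂
      (p := fun x y => mapFun f g (x + y) = mapFun f g x + mapFun f g y)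
      (isClosed_eq ((continuous_mapFun f g).comp continuous_add)
        (((continuous_mapFun f g).comp continuous_fst).add
          ((continuous_mapFun f g).comp continuous_snd))) (fun s t => ?_) x y
    rw [← map_add, mapFun_incl, mapFun_incl, mapFun_incl, map_add, map_add]
  commutes' c := by rw [← incl.commutes c, mapFun_incl, (algMap f g).commutes, incl.commutes]
  map_star' x := by
    refine denseRange_incl.induction_on (p := fun x => mapFun f g (star x) = star (mapFun f g x)) x
      (isClosed_eq ((continuous_mapFun f g).comp continuous_star')
        (continuous_star'.comp (continuous_mapFun f g))) fun t => ?_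
    rw [star_incl, mapFun_incl, mapFun_incl, star_incl]
    exact congrArg incl (star_map f g t)

theorem map_tmul (f : C →⋆ₐ[ℂ] A) (g : D →⋆ₐ[ℂ] B) (c : C) (d : D) :
    map f g (tmul c d) = tmul (f c) (g d) := mapFun_incl f g _

theorem tmul_mul_tmul (a a' : A) (b b' : B) :
    tmul a b * tmul a' b' = tmul (a * a') (b * b') :=
  (map_mul incl (a ⊗ₜ[ℂ] b : A ⊗[ℂ] B) (a' ⊗ₜ[ℂ] b' : A ⊗[ℂ] B)).symm.trans
    (congrArg incl (Algebra.TensorProduct.tmul_mul_tmul a a' b b'))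

theorem star_tmul (a : A) (b : B) : star (tmul a b) = tmul (star a) (star b) := star_incl _

theorem one_tmul_one : (tmul 1 1 : MinTensor A B) = 1 := map_one incl

theorem map_id (x : MinTensor A B) : map (StarAlgHom.id ℂ A) (StarAlgHom.id ℂ B) x = x := by
  refine denseRange_incl.induction_on (p := fun x => mapFun (.id ℂ A) (.id ℂ B) x = x) x
    (isClosed_eq (continuous_mapFun _ _) continuous_id) fun t => ?_
  rw [mapFun_incl]
  exact congrArg incl (DFunLike.congr_fun (Algebra.TensorProduct.map_id (R := ℂ) (S := ℂ)) t)

variable {P Q : Type*} [CStarAlgebra P] [CStarAlgebra Q]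

theorem map_map (f : C →⋆ₐ[ℂ] A) (g : D →⋆ₐ[ℂ] B) (f' : A →⋆ₐ[ℂ] P) (g' : B →⋆ₐ[ℂ] Q)
    (x : MinTensor C D) : map f' g' (map f g x) = map (f'.comp f) (g'.comp g) x := by
  refine denseRange_incl.induction_on
    (p := fun x => mapFun f' g' (mapFun f g x) = mapFun (f'.comp f) (g'.comp g) x) x
    (isClosed_eq ((continuous_mapFun _ _).comp (continuous_mapFun _ _))
      (continuous_mapFun _ _)) fun t => ?_
  rw [mapFun_incl, mapFun_incl, mapFun_incl]
  refine congrArg incl ?_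
  exact (DFunLike.congr_fun (Algebra.TensorProduct.map_comp (R := ℂ) (S := ℂ)
    f'.toAlgHom f.toAlgHom g'.toAlgHom g.toAlgHom) t).symm

/-- The graph of the canonical isomorphism `(A ⊗ B) ⊗ C ≅ A ⊗ (B ⊗ C)`, `(a ⊗ b) ⊗ c ↦ a ⊗ (b ⊗ c)`.
The isomorphism is isometric, so its graph is the closed linear span of the pairs
`((a ⊗ b) ⊗ c, a ⊗ (b ⊗ c))`. -/
noncomputable def assocGraph (A B C : Type*) [CStarAlgebra A] [CStarAlgebra B] [CStarAlgebra C] : Submodule ℂ (MinTensor (MinTensor A B) C × MinTensor A (MinTensor B C)) :=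
  (Submodule.span ℂ {p | ∃ a b c, p = (tmul (tmul a b) c, tmul a (tmul b c))}).topologicalClosure

end Completion
end CStarTensor

open CStarTensor CategoryTheory

universe u v w

/-- A compact quantum group `G`: a unital C⋆-algebra `C(G)` (here `alg`, not zero) with a unital
⋆-homomorphism `Δ : C(G) → C(G) ⊗ C(G)` that is coassociative and bisimplifiable. -/
structure CompactQuantumGroup where
  /-- The C⋆-algebra `C(G)`. -/
  alg : Type u
  [cstar : CStarAlgebra alg]
  [nontrivial : Nontrivial alg]
  /-- The comultiplication `Δ`. -/
  comul : alg →⋆ₐ[ℂ] MinTensor alg alg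
  /-- `(Δ ⊗ id) Δ = (id ⊗ Δ) Δ`, up to the canonical identification of the threefold tensor
  products. -/
  coassoc : ∀ a, (map comul (.id ℂ alg) (comul a), map (.id ℂ alg) comul (comul a)) ∈
    assocGraph alg alg alg
  dense_comul_mul_right : Dense
    (Submodule.span ℂ {x | ∃ a b, x = comul a * tmul 1 b} : Set (MinTensor alg alg))
  dense_comul_mul_left : Dense
    (Submodule.span ℂ {x | ∃ a b, x = comul a * tmul b 1} : Set (MinTensor alg alg))

attribute [instance] CompactQuantumGroup.cstar CompactQuantumGroup.nontrivial

namespace CompactQuantumGroup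

/-- An isomorphism of compact quantum groups. -/
structure Iso (G H : CompactQuantumGroup.{u}) where
  /-- The underlying isomorphism of C⋆-algebras. -/
  equiv : G.alg ≃⋆ₐ[ℂ] H.alg
  map_comul : ∀ a, map (equiv : G.alg →⋆ₐ[ℂ] H.alg) (equiv : G.alg →⋆ₐ[ℂ] H.alg) (G.comul a) =
    H.comul (equiv a)

variable (G : CompactQuantumGroup.{u}) {X : Type v} [Fintype X] [DecidableEq X]

/-- For a finite set `X`, the tensor products `C(X) ⊗ C(G)` and `C(X) ⊗ C(G) ⊗ C(G)` are the spaces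
of functions on `X` with values in `C(G)` and in `C(G) ⊗ C(G)`. In this identification
`F = ∑ y, δ_y ⊗ F y`, so `(β ⊗ id) F` is the function `x ↦ ∑ y, β δ_y x ⊗ F y`, and `(id ⊗ Δ) F` is
`x ↦ Δ (F x)`.
A linear map `β : C(X) → C(X) ⊗ C(G)` is a coaction if it is coassociative,
`(β ⊗ id) β = (id ⊗ Δ) β`, and satisfies the Podleś condition `[β(C(X)) (1 ⊗ C(G))] = C(X) ⊗ C(G)`. -/
structure IsCoaction (β : (X → ℂ) →ₗ[ℂ] (X → G.alg)) : Prop where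
  coassoc : ∀ ξ x, ∑ y, tmul (β (Pi.single y 1) x) (β ξ y) = G.comul (β ξ x)
  podles : Dense
    (Submodule.span ℂ {F | ∃ ξ a, F = fun x => β ξ x * a} : Set (X → G.alg))

/-- `(C(X), α)` is a `G`-C⋆-algebra. -/
def IsGAlgebra (α : (X → ℂ) →⋆ₐ[ℂ] (X → G.alg)) : Prop :=
  G.IsCoaction α.toAlgHom.toLinearMap

/-- The action `α` is faithful: the ⋆-algebra generated by the slices `(ω ⊗ id) α(f)`, with `ω` in
the dual of `C(X)`, is norm-dense in `C(G)`. -/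
def IsFaithful (α : (X → ℂ) →⋆ₐ[ℂ] (X → G.alg)) : Prop :=
  Dense (NonUnitalStarAlgebra.adjoin ℂ
    {c | ∃ (ω : (X → ℂ) →L[ℂ] ℂ) (f : X → ℂ), c = ∑ x, ω (Pi.single x 1) • α f x} : Set G.alg)

end CompactQuantumGroup

/-- A directed graph with vertex set `V` and edge set `E`, loops and multiple edges allowed. -/
structure DirectedGraph (V : Type v) (E : Type w) where
  /-- The source map. -/
  s : E → V
  /-- The range map. -/
  r : E → V

namespace DirectedGraph

section Correspondence

variable {V : Type v} {E : Type w} (𝒢 : DirectedGraph V E) {A : Type u} [CStarAlgebra A]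

/-- No loops and no multiple edges. -/
structure IsSimple (𝒢 : DirectedGraph V E) : Prop where
  no_loops : ∀ e, 𝒢.s e ≠ 𝒢.r e
  no_multiple_edges : ∀ e f, 𝒢.s e = 𝒢.s f → 𝒢.r e = 𝒢.r f → e = f

/-- The right action `(ξ · f)(e) = ξ(e) f(r(e))`. For `A = ℂ` this is the Hilbert `C(𝒢⁰)`-module
`C(𝒢¹)`; for `A = C(G)` it is its external tensor product with `C(G)`, a Hilbert module over
`C(𝒢⁰) ⊗ C(G)`. -/
def rightMul (ξ : E → A) (f : V → A) : E → A :=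
  fun e => ξ e * f (𝒢.r e)

/-- The left action `(φ(f) ξ)(e) = f(s(e)) ξ(e)`; for `A = C(G)` this is `φ ⊗ id`. -/
def leftMul (f : V → A) (ξ : E → A) : E → A :=
  fun e => f (𝒢.s e) * ξ e

/-- The inner product `⟨ξ, η⟩(v) = ∑_{r(e) = v} ξ(e)⋆ η(e)`. -/
def edgeInner [DecidableEq V] [Fintype E] (ξ η : E → A) : V → A :=
  fun v => ∑ e with 𝒢.r e = v, star (ξ e) * η e

end Correspondence

section Category

variable {V : Type v} {E : Type w} [Fintype V] [DecidableEq V] [Fintype E] [DecidableEq E]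
  (𝒢 : DirectedGraph V E)

/-- `(C(𝒢¹), φ, λ)` is a `G`-equivariant C⋆-correspondence over the `G`-C⋆-algebra `(C(𝒢⁰), α)`:
`λ(ξ f) = λ(ξ) α(f)`, `⟨λ(ξ), λ(η)⟩ = α(⟨ξ, η⟩)`, `λ` is coassociative and satisfies the Podleś
condition, and `φ` is equivariant, `λ(φ(f) ξ) = (φ ⊗ id)(α(f)) λ(ξ)`. -/
structure IsEquivariantCorrespondence (G : CompactQuantumGroup.{u})
    (α : (V → ℂ) →⋆ₐ[ℂ] (V → G.alg)) (lam : (E → ℂ) →ₗ[ℂ] (E → G.alg)) : Prop where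
  map_rightMul : ∀ ξ f, lam (𝒢.rightMul ξ f) = 𝒢.rightMul (lam ξ) (α f)
  map_edgeInner : ∀ ξ η, 𝒢.edgeInner (lam ξ) (lam η) = α (𝒢.edgeInner ξ η)
  coaction : G.IsCoaction lam
  map_leftMul : ∀ f ξ, lam (𝒢.leftMul f ξ) = 𝒢.leftMul (α f) (lam ξ)

/-- The objects `(G, α, λ)` of the category `C_Ban(𝒢)`. -/
structure BanObj where
  /-- The compact quantum group. -/
  G : CompactQuantumGroup.{u}
  /-- The action `α` on `C(𝒢⁰)`. -/
  act : (V → ℂ) →⋆ₐ[ℂ] (V → G.alg)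
  /-- The action `λ` on `C(𝒢¹)`. -/
  edgeAct : (E → ℂ) →ₗ[ℂ] (E → G.alg)
  isGAlgebra : G.IsGAlgebra act
  faithful : G.IsFaithful act
  equivariant : 𝒢.IsEquivariantCorrespondence G act edgeAct
  /-- `(r_* ⊗ id) α(f) = λ(r_*(f))`, where `r_*(f) = f ∘ r`. -/
  range_compat : ∀ (f : V → ℂ) (e : E), act f (𝒢.r e) = edgeAct (f ∘ 𝒢.r) e

namespace BanObj

variable {𝒢}

/-- A morphism `(G₁, α₁, λ₁) → (G₂, α₂, λ₂)` is a Hopf ⋆-homomorphism `f : C(G₂) → C(G₁)` with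
`(id ⊗ f) α₂ = α₁` and `(id ⊗ f) λ₂ = λ₁`. -/
@[ext]
structure Hom (X Y : BanObj.{u} 𝒢) where
  /-- The Hopf ⋆-homomorphism. -/
  hom : Y.G.alg →⋆ₐ[ℂ] X.G.alg
  map_comul : ∀ a, map hom hom (Y.G.comul a) = X.G.comul (hom a)
  map_act : ∀ f v, hom (Y.act f v) = X.act f v
  map_edgeAct : ∀ ξ e, hom (Y.edgeAct ξ e) = X.edgeAct ξ e

/-- The category `C_Ban(𝒢)`. -/
instance : Category (BanObj.{u} 𝒢) where
  Hom := Hom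
  id X := ⟨.id ℂ _, fun a => map_id _, fun _ _ => rfl, fun _ _ => rfl⟩
  comp f g := ⟨f.hom.comp g.hom,
    fun a => by rw [← map_map, g.map_comul, f.map_comul]; rfl,
    fun a v => by simp [g.map_act, f.map_act], fun ξ e => by simp [g.map_edgeAct, f.map_edgeAct]⟩

end BanObj

end Category

section Banica

variable {V : Type v} {E : Type w} [Fintype V] [DecidableEq V] [Fintype E]
  (𝒢 : DirectedGraph V E)

/-- The adjacency matrix `D`, with `D v w = 1` if there is an edge from `v` to `w`, and `0` if not,
read in a C⋆-algebra `A`. -/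
def adjacency (A : Type u) [CStarAlgebra A] : Matrix V V A :=
  Matrix.of fun v w => if ∃ e, 𝒢.s e = v ∧ 𝒢.r e = w then 1 else 0

/-- The relations of `C(Aut⁺_Ban(𝒢))`: those of the quantum permutation group of the vertex set,
`q v w = (q v w)⋆ = (q v w)²` and `∑_w q v w = ∑_v q v w = 1`, together with `q D = D q`. -/
structure BanicaRelations {A : Type u} [CStarAlgebra A] (q : Matrix V V A) : Prop where
  star_eq : ∀ v w, star (q v w) = q v w
  sq_eq : ∀ v w, q v w * q v w = q v w
  sum_row : ∀ v, ∑ w, q v w = 1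
  sum_col : ∀ w, ∑ v, q v w = 1
  comm_adjacency : q * 𝒢.adjacency A = 𝒢.adjacency A * q

/-- `H` is the quantum automorphism group `Aut⁺_Ban(𝒢)`: `C(H)` is the universal unital C⋆-algebra
generated by the entries of a matrix `q` with the above relations, and
`Δ(q v w) = ∑ x, q v x ⊗ q x w`. This determines `H` up to isomorphism. -/
def IsAutBan (H : CompactQuantumGroup.{u}) : Prop :=
  ∃ q : Matrix V V H.alg, 𝒢.BanicaRelations q ∧
    (∀ (B : Type u) [CStarAlgebra B] (b : Matrix V V B), 𝒢.BanicaRelations b →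
      ∃! f : H.alg →⋆ₐ[ℂ] B, ∀ v w, f (q v w) = b v w) ∧
    ∀ v w, H.comul (q v w) = ∑ x, tmul (q v x) (q x w)

end Banica

end DirectedGraph

/-! Banica's algebra is the universal C⋆-algebra of a magic unitary `q` commuting with the adjacency
matrix, and the claim is that an object of the category is the same thing as a quantum group densely
generated by the entries of such a matrix. The generators are projections, so every noncommutative
polynomial in them is bounded uniformly over all representations, and the universal algebra is a
completion of the free ⋆-algebra. Its comultiplication comes from the universal property, as `∑ x, q
v x ⊗ q x w` again satisfies the relations (`BanicaRelations.comul`).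

From `q` to an object: the vertices carry `δ_w ↦ ∑ v, δ_v ⊗ q v w`, the edges carry `δ_f ↦ ∑ e, δ_e
⊗ q (s e) (s f) * q (r e) (r f)`. The decisive fact is `BanicaRelations.mul_eq_zero`: `q v y * q z
w` vanishes unless `(v, z)` and `(y, w)` are both edges or both non-edges. In a simple graph, sums
over edges thus become sums over all pairs of vertices, which the row and column sums of `q`
evaluate.

From an object to `q`: let `u` be the matrix of the vertex action. Since `α` is a unital
⋆-homomorphism, the rows of `u` are partitions of unity into projections. Equivariance of the left
action together with compatibility with the range map gives `u (s e) x * u (r e) y = ∑ λ e f`,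
summed over the edges `f` from `x` to `y`. In a simple graph this determines `λ` from `u`, and it
makes the product vanish when there is no edge from `x` to `y`. That is half of the adjacency
relation; the other half follows by counting, because the entries of `uD` and `Du` are projections,
the former dominate the latter, and their total sums agree.

The analytic point is that the columns of `u` sum to one (`sum_col_eq_one`). In place of a Haar
state, the proof takes a state `φ` faithful on the span of `1` and the entries of `u`, and a
stationary distribution `c` of the stochastic matrix `φ(u)`. A monotonicity argument along the
convolution powers of `φ` upgrades `c φ(u) = c` to `c u = c` in the algebra. With a right inverse of
`u`, supplied by the Podleś condition, this forces `c` to be strictly positive and constant along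
the nonzero entries of `u`, whence the column sums. -/

/-! ### States, separation by states, and product states -/

section States

open scoped ComplexOrder TensorProduct ComplexConjugate

variable {A B : Type*} [CStarAlgebra A] [CStarAlgebra B]

/-- A state on a unital C⋆-algebra. -/
structure IsState (φ : A →ₗ[ℂ] ℂ) : Prop where
  map_one : φ 1 = 1
  nonneg : ∀ a, 0 ≤ φ (star a * a)

namespace IsState

variable {φ ψ : A →ₗ[ℂ] ℂ}

theorem conj_symm (h : IsState φ) (x y : A) : conj (φ (star y * x)) = φ (star x * y) :=
  conj_symm_of_nonneg (fun x y => φ (star x * y)) (by intros; simp [add_mul])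
    (by intros; simp [mul_add]) (by intros; simp) (by intros; simp) h.nonneg x y

/-- The semi-inner product `φ(x⋆ y)`. -/
@[reducible] noncomputable def core (h : IsState φ) : PreInnerProductSpace.Core ℂ A where
  inner x y := φ (star x * y)
  conj_inner_symm x y := h.conj_symm x y
  re_inner_nonneg x := (Complex.nonneg_iff.1 (h.nonneg x)).1
  add_left x y z := by simp [add_mul]
  smul_left x y c := by simp

theorem re_nonneg (h : IsState φ) (x : A) : 0 ≤ (φ (star x * x)).re :=
  (Complex.nonneg_iff.1 (h.nonneg x)).1

theorem eq_ofReal_re (h : IsState φ) (x : A) : φ (star x * x) = ((φ (star x * x)).re : ℂ) :=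
  Complex.ext rfl (Complex.nonneg_iff.1 (h.nonneg x)).2.symm

theorem norm_sq_le (h : IsState φ) (x y : A) :
    ‖φ (star x * y)‖ ^ 2 ≤ (φ (star x * x)).re * (φ (star y * y)).re := by
  have := @InnerProductSpace.Core.norm_inner_le_norm ℂ _ _ _ _ h.core x y
  change ‖φ (star x * y)‖ ≤ √(φ (star x * x)).re * √(φ (star y * y)).re at this
  calc _ ≤ (√(φ (star x * x)).re * √(φ (star y * y)).re) ^ 2 := by gcongr
    _ = _ := by rw [mul_pow, Real.sq_sqrt (h.re_nonneg x), Real.sq_sqrt (h.re_nonneg y)]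

theorem re_star_mul_self_le (h : IsState φ) (a : A) : (φ (star a * a)).re ≤ ‖a‖ ^ 2 := by
  obtain ⟨c, hc⟩ := exists_norm_sq_sub a
  have := h.re_nonneg c
  rw [hc, map_sub, map_smul, h.map_one, Complex.sub_re, smul_eq_mul, mul_one,
    Complex.ofReal_re, sub_nonneg] at this
  exact this

theorem norm_le (h : IsState φ) (a : A) : ‖φ a‖ ≤ ‖a‖ := by
  have h1 := h.norm_sq_le 1 a
  have h2 := h.re_star_mul_self_le a
  simp only [star_one, one_mul, h.map_one, Complex.one_re] at h1
  exact le_of_sq_le_sq (h1.trans h2) (norm_nonneg _)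

theorem midpoint (h : IsState φ) (h' : IsState ψ) : IsState ((2⁻¹ : ℂ) • (φ + ψ)) where
  map_one := by simp [h.map_one, h'.map_one]; norm_num
  nonneg a := by
    have h2 : (0 : ℂ) ≤ 2⁻¹ := by
      rw [Complex.nonneg_iff]; norm_num
    exact mul_nonneg h2 (add_nonneg (h.nonneg a) (h'.nonneg a))

theorem comp (h : IsState φ) (f : B →⋆ₐ[ℂ] A) : IsState (φ ∘ₗ f.toAlgHom.toLinearMap) where
  map_one := by simp [h.map_one]
  nonneg b := by simpa [map_star] using h.nonneg (f b)

end IsState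

/-- Hahn–Banach: `-(a⋆ a)` lies outside the closed cone of positive elements, and a real functional
separating the two is, after complexification and normalisation, the required state. -/
theorem exists_isState_ne_zero {a : A} (ha : a ≠ 0) :
    ∃ φ : A →ₗ[ℂ] ℂ, IsState φ ∧ φ (star a * a) ≠ 0 := by
  let _ := CStarAlgebra.spectralOrder A
  have := CStarAlgebra.spectralOrderedRing A
  let C : ProperCone ℝ A :=
    { carrier := {x | 0 ≤ x}
      add_mem' := fun {x y} hx hy => show (0 : A) ≤ x + y from add_nonneg hx hy
      zero_mem' := le_refl (0 : A)
      smul_mem' := fun c x hx => show (0 : A) ≤ (c : ℝ) • x from smul_nonneg c.2 hx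
      isClosed' := CStarAlgebra.isClosed_nonneg }
  have hC : ∀ x, x ∈ C ↔ 0 ≤ x := fun x => Iff.rfl
  have hn : -(star a * a) ∉ C := fun h => by
    rw [hC, Left.nonneg_neg_iff] at h
    exact ha (CStarRing.star_mul_self_eq_zero_iff a |>.1 (le_antisymm h (star_mul_self_nonneg a)))
  obtain ⟨f, hf, hfa⟩ := C.hyperplane_separation_point hn
  rw [map_neg, neg_lt_zero] at hfa
  -- From `a⋆ a ≤ ‖a‖² · 1` one gets `0 < f (a⋆ a) ≤ ‖a‖² f 1`, so normalisation is possible.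
  have hf1 : 0 < f 1 := by
    have h1 := hf _ ((hC _).2 (sub_nonneg.2
      (CStarAlgebra.star_mul_le_algebraMap_norm_sq (a := a))))
    rw [map_sub, sub_nonneg, Algebra.algebraMap_eq_smul_one, map_smul, smul_eq_mul] at h1
    by_contra h
    nlinarith [sq_nonneg ‖a‖]
  let g : A →ₗ[ℝ] ℂ := (Complex.ofRealCLM : ℝ →ₗ[ℝ] ℂ) ∘ₗ (f : A →ₗ[ℝ] ℝ)
  let re : A →ₗ[ℝ] A := (selfAdjoint.submodule ℝ A).subtype ∘ₗ realPart
  let im : A →ₗ[ℝ] A := (selfAdjoint.submodule ℝ A).subtype ∘ₗ imaginaryPart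
  -- Complex-linear extension of `f` from the self-adjoint part, via `x = Re x + i Im x`.
  let φ₀ : A →ₗ[ℝ] ℂ := g ∘ₗ re + (LinearMap.mulLeft ℝ Complex.I) ∘ₗ g ∘ₗ im
  have hφ₀ : ∀ x, φ₀ x = (f (realPart x : A) : ℂ) + Complex.I * (f (imaginaryPart x : A) : ℂ) :=
    fun x => rfl
  let φ : A →ₗ[ℂ] ℂ :=
    { toFun := φ₀
      map_add' := φ₀.map_add
      map_smul' := fun c x => by
        rw [hφ₀, hφ₀, realPart_smul, imaginaryPart_smul]
        simp only [AddSubgroupClass.coe_sub, selfAdjoint.val_smul,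
          AddMemClass.coe_add, map_sub, map_add, map_smul, smul_eq_mul, RingHom.id_apply]
        apply Complex.ext <;> simp }
  have hsa : ∀ x : A, IsSelfAdjoint x → φ x = (f x : ℂ) := fun x hx => by
    change φ₀ x = _
    rw [hφ₀, hx.coe_realPart, hx.imaginaryPart]
    simp
  have h1 : φ 1 = (f 1 : ℂ) := hsa 1 (.one A)
  have h2 : ∀ x, φ (star x * x) = (f (star x * x) : ℂ) := fun x => hsa _ (.star_mul_self x)
  refine ⟨((f 1)⁻¹ : ℂ) • φ, ⟨?_, fun x => ?_⟩, ?_⟩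
  · rw [LinearMap.smul_apply, h1, smul_eq_mul, inv_mul_cancel₀]
    exact_mod_cast hf1.ne'
  · rw [LinearMap.smul_apply, h2, smul_eq_mul]
    exact_mod_cast mul_nonneg (inv_nonneg.2 hf1.le) (hf _ ((hC _).2 (star_mul_self_nonneg x)))
  · rw [LinearMap.smul_apply, h2, smul_eq_mul]
    exact_mod_cast mul_ne_zero (inv_ne_zero hf1.ne') hfa.ne'

/-- A general C⋆-algebra has no faithful state, but finite dimension permits an induction: a state
not vanishing on `z₀⋆ z₀` cuts the subspace down to its intersection with the left kernel, and
averaging with a state faithful there settles the whole subspace. -/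
theorem exists_isState_faithful_on [Nontrivial A] (W : Submodule ℂ A) [FiniteDimensional ℂ W] :
    ∃ φ : A →ₗ[ℂ] ℂ, IsState φ ∧ ∀ z ∈ W, φ (star z * z) = 0 → z = 0 := by
  induction h : Module.finrank ℂ W using Nat.strong_induction_on generalizing W with
  | _ n ih =>
  by_cases hW : W = ⊥
  · obtain ⟨φ, hφ, -⟩ := exists_isState_ne_zero (one_ne_zero (α := A))
    refine ⟨φ, hφ, fun z hz _ => ?_⟩
    rwa [hW, Submodule.mem_bot] at hz
  obtain ⟨z₀, hz₀, hne⟩ := W.ne_bot_iff.1 hW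
  obtain ⟨ψ, hψ, hψ0⟩ := exists_isState_ne_zero hne
  -- The left kernel of `ψ`. This form is visibly linear; by Cauchy–Schwarz it contains every `z`
  -- with `ψ (z⋆ z) = 0`.
  let N : Submodule ℂ A :=
    { carrier := {z | ∀ a, ψ (star a * z) = 0}
      add_mem' := fun hx hy a => by rw [mul_add, map_add, hx a, hy a, add_zero]
      zero_mem' := fun a => by simp
      smul_mem' := fun c x hx a => by rw [mul_smul_comm, map_smul, hx a, smul_zero] }
  have hlt : W ⊓ N < W := lt_of_le_of_ne inf_le_left fun h => by
    rw [← h] at hz₀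
    exact hψ0 (hz₀.2 z₀)
  have : FiniteDimensional ℂ (W ⊓ N : Submodule ℂ A) :=
    Submodule.finiteDimensional_of_le inf_le_left
  obtain ⟨φ, hφ, H⟩ := ih _ (h ▸ Submodule.finrank_lt_finrank_of_lt hlt) (W ⊓ N) rfl
  refine ⟨_, hψ.midpoint hφ, fun z hz h0 => ?_⟩
  have h0 : ψ (star z * z) + φ (star z * z) = 0 :=
    (smul_eq_zero.1 (show (2⁻¹ : ℂ) • (ψ (star z * z) + φ (star z * z)) = 0 from h0)).resolve_left
      (by norm_num)
  obtain ⟨h1, h2⟩ := (add_eq_zero_iff_of_nonneg (hψ.nonneg z) (hφ.nonneg z)).1 h0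
  refine H z ⟨hz, fun a => ?_⟩ h2
  have := hψ.norm_sq_le a z
  rw [h1, Complex.zero_re, mul_zero] at this
  simpa using this

/-- The product functional is a vector functional with a one-point index set. Cauchy–Schwarz against
`1` bounds it by the minimal norm, so it extends to the completion, and positivity passes to limits.
-/
theorem exists_isState_tensor {φ : A →ₗ[ℂ] ℂ} {ψ : B →ₗ[ℂ] ℂ} (hφ : IsState φ)
    (hψ : IsState ψ) : ∃ Ω : MinTensor A B →ₗ[ℂ] ℂ, IsState Ω ∧
      ∀ a b, Ω (tmul a b) = φ a * ψ b := by
  let Ω₀ : A ⊗[ℂ] B →ₗ[ℂ] ℂ := kernelFunctional (ι := Unit) (fun _ _ => φ) (fun _ _ => ψ)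
  have hv : IsVectorFunctional Ω₀ :=
    ⟨Unit, inferInstance, _, _, fun a => by simpa using hφ.nonneg (a ()),
      fun a => by simpa using hψ.nonneg (a ()), rfl⟩
  have ht : ∀ a b, Ω₀ (a ⊗ₜ b) = φ a * ψ b := fun a b => by
    simp [Ω₀, kernelFunctional_tmul]
  have h1 : Ω₀ 1 = 1 := by
    rw [Algebra.TensorProduct.one_def, ht, hφ.map_one, hψ.map_one, one_mul]
  have hb : ∀ t : A ⊗[ℂ] B, ‖Ω₀ t‖ ≤ 1 * minNorm t := fun t => by
    have hc := hv.cauchy 1 t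
    rw [star_one, one_mul] at hc
    refine hc.trans (mul_le_mul ?_ (vnorm_le hv (by simp [h1]) t) (Real.sqrt_nonneg _) zero_le_one)
    exact Real.sqrt_le_one.2 (by simp [h1])
  let L : AlgTensor A B →L[ℂ] ℂ := LinearMap.mkContinuous
    (show AlgTensor A B →ₗ[ℂ] ℂ from Ω₀) 1 hb
  let i : AlgTensor A B →L[ℂ] MinTensor A B := ⟨incl.toLinearMap, continuous_incl⟩
  have hi : IsUniformInducing i := UniformSpace.Completion.isUniformInducing_coe _
  let Ω : MinTensor A B →L[ℂ] ℂ := L.extend i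
  have hΩ : ∀ t, Ω (incl t) = L t := fun t => L.extend_eq denseRange_incl hi t
  refine ⟨Ω, ⟨?_, fun x => ?_⟩, fun a b => (hΩ _).trans (ht a b)⟩
  · rw [← map_one incl]
    exact (hΩ 1).trans h1
  · refine denseRange_incl.induction_on (p := fun x => 0 ≤ Ω (star x * x)) x
      (isClosed_le continuous_const (Ω.continuous.comp (continuous_star'.mul continuous_id)))
      fun t => ?_
    rw [star_incl, ← map_mul, hΩ]
    exact hv.nonneg t

end States

/-! ### Bilinearity of elementary tensors -/

namespace CStarTensor

open scoped TensorProduct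

variable {A B : Type*} [CStarAlgebra A] [CStarAlgebra B]

theorem tmul_add (a : A) (b b' : B) : tmul a (b + b') = tmul a b + tmul a b' :=
  (congrArg incl (TensorProduct.tmul_add a b b')).trans (map_add incl _ _)

theorem add_tmul (a a' : A) (b : B) : tmul (a + a') b = tmul a b + tmul a' b :=
  (congrArg incl (TensorProduct.add_tmul a a' b)).trans (map_add incl _ _)

theorem tmul_smul (c : ℂ) (a : A) (b : B) : tmul a (c • b) = c • tmul a b :=
  (congrArg incl (TensorProduct.tmul_smul c a b)).trans (map_smul incl _ _)

theorem smul_tmul (c : ℂ) (a : A) (b : B) : tmul (c • a) b = c • tmul a b :=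
  (congrArg incl (TensorProduct.smul_tmul' c a b).symm).trans (map_smul incl _ _)

/-- The elementary tensor as a bilinear map. -/
noncomputable def tmulBilin : A →ₗ[ℂ] B →ₗ[ℂ] MinTensor A B :=
  LinearMap.mk₂ ℂ tmul add_tmul smul_tmul tmul_add tmul_smul

theorem sum_tmul {ι : Type*} (s : Finset ι) (a : ι → A) (b : B) :
    tmul (∑ i ∈ s, a i) b = ∑ i ∈ s, tmul (a i) b :=
  map_sum ((tmulBilin (A := A)).flip b) a s

theorem tmul_sum {ι : Type*} (s : Finset ι) (a : A) (b : ι → B) :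
    tmul a (∑ i ∈ s, b i) = ∑ i ∈ s, tmul a (b i) :=
  map_sum (tmulBilin a) b s

theorem sub_tmul (a a' : A) (b : B) : tmul (a - a') b = tmul a b - tmul a' b :=
  map_sub ((tmulBilin (A := A)).flip b) a a'

theorem tmul_zero (a : A) : tmul a (0 : B) = 0 := map_zero (tmulBilin a)

theorem zero_tmul (b : B) : tmul (0 : A) b = 0 := map_zero ((tmulBilin (A := A)).flip b)

end CStarTensor

/-! ### Stationary distributions of stochastic matrices -/

section Stationary

open Filter Topology

/-- Telescoping gives `k d ≤ K (s k - s 0) ≤ 2 K M` for all `k`: a bounded sequence cannot grow by a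
fixed positive amount at each step. -/
theorem eq_zero_of_forall_le_mul_sub {s : ℕ → ℝ} {d K M : ℝ} (hd : 0 ≤ d) (hK : 0 ≤ K)
    (hM : ∀ k, |s k| ≤ M) (h : ∀ k, d ≤ K * (s (k + 1) - s k)) : d = 0 := by
  have hs : ∀ k : ℕ, k * d ≤ K * (s k - s 0) := by
    intro k
    induction k with
    | zero => simp
    | succ k ih => have := h k; push_cast; linarith
  have hb : ∀ k : ℕ, k * d ≤ K * (2 * M) := fun k =>
    (hs k).trans (mul_le_mul_of_nonneg_left (by
      have h1 := abs_le.1 (hM k); have h2 := abs_le.1 (hM 0); linarith) hK)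
  by_contra hne
  have hpos : 0 < d := lt_of_le_of_ne hd (Ne.symm hne)
  obtain ⟨k, hk⟩ := exists_nat_gt (K * (2 * M) / d)
  rw [div_lt_iff₀ hpos] at hk
  exact absurd (hb k) (not_le.2 hk)

/-- A stochastic matrix has a stationary distribution that, on harmonic functions, agrees with the
counting measure. -/
theorem exists_stationary {X : Type*} [Fintype X] [DecidableEq X] (P : Matrix X X ℝ)
    (h0 : ∀ v w, 0 ≤ P v w) (h1 : ∀ v, ∑ w, P v w = 1) :
    ∃ c : X → ℝ, (∀ v, 0 ≤ c v) ∧ (∀ w, ∑ v, c v * P v w = c w) ∧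
      ∀ f : X → ℝ, (∀ v, ∑ w, P v w * f w = f v) → ∑ v, c v * f v = ∑ v, f v := by
  -- The counting measure pushed through `k` steps of the chain. Its pairing with a harmonic
  -- function does not depend on `k`, and the function `1` is harmonic, so all `e k` lie in a fixed
  -- box.
  let e : ℕ → X → ℝ := fun k => (fun x => Matrix.vecMul x P)^[k] 1
  have he : ∀ k w, e (k + 1) w = ∑ v, e k v * P v w := fun k w => by
    simp only [e, Function.iterate_succ_apply']
    rfl
  have hnn : ∀ k v, 0 ≤ e k v := by
    intro k
    induction k with
    | zero => intro v; simp [e]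
    | succ k ih => intro v; rw [he]; exact Finset.sum_nonneg fun x _ => mul_nonneg (ih x) (h0 x v)
  have hf : ∀ f : X → ℝ, (∀ v, ∑ w, P v w * f w = f v) → ∀ k, ∑ v, e k v * f v = ∑ v, f v := by
    intro f hf k
    induction k with
    | zero => simp [e]
    | succ k ih =>
      rw [← ih]
      simp only [he, Finset.sum_mul]
      rw [Finset.sum_comm]
      refine Finset.sum_congr rfl fun v _ => ?_
      rw [← hf v, Finset.mul_sum]
      simp [mul_assoc]
  let n : ℝ := Fintype.card X
  have hle : ∀ k v, e k v ≤ n := by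
    intro k v
    have := hf 1 (by simpa using h1) k
    simp only [Pi.one_apply, mul_one, Finset.sum_const, Finset.card_univ, nsmul_eq_mul] at this
    exact (Finset.single_le_sum (f := e k) (fun i _ => hnn k i) (Finset.mem_univ v)).trans_eq this
  -- Cesàro means: each misses stationarity by `(e (k + 1) - e 0) / (k + 1)`, so any limit point is
  -- stationary.
  let a : ℕ → X → ℝ := fun k v => ((k : ℝ) + 1)⁻¹ * ∑ i ∈ Finset.range (k + 1), e i v
  have hk : ∀ k : ℕ, (0 : ℝ) < (k : ℝ) + 1 := fun k => by positivity
  have ha : ∀ k, a k ∈ Set.Icc (0 : X → ℝ) (fun _ => n) := fun k => by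
    refine ⟨fun v => ?_, fun v => ?_⟩
    · exact mul_nonneg (inv_nonneg.2 (hk k).le) (Finset.sum_nonneg fun i _ => hnn i v)
    · rw [inv_mul_le_iff₀ (hk k)]
      refine (Finset.sum_le_card_nsmul _ _ n fun i _ => hle i v).trans ?_
      simp
  obtain ⟨c, hc, σ, hσ, hlim⟩ := isCompact_Icc.tendsto_subseq ha
  rw [tendsto_pi_nhds] at hlim
  refine ⟨c, hc.1, fun w => ?_, fun f hff => ?_⟩
  · have hdiff : ∀ k, |∑ v, a k v * P v w - a k w| ≤ n * ((k : ℝ) + 1)⁻¹ := fun k => by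
      have : ∑ v, a k v * P v w - a k w = ((k : ℝ) + 1)⁻¹ * (e (k + 1) w - e 0 w) := by
        rw [← Finset.sum_range_sub (fun i => e i w), Finset.sum_sub_distrib, mul_sub]
        congr 1
        simp only [a, mul_assoc, ← Finset.mul_sum, he]
        congr 1
        simp only [Finset.sum_mul]
        exact Finset.sum_comm
      rw [this, abs_mul, abs_of_pos (inv_pos.2 (hk k)), mul_comm]
      refine mul_le_mul_of_nonneg_right ?_ (inv_pos.2 (hk k)).le
      have := hnn (k + 1) w; have := hnn 0 w; have := hle (k + 1) w; have := hle 0 w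
      rw [abs_le]; constructor <;> linarith
    have hz : Tendsto (fun k : ℕ => n * ((k : ℝ) + 1)⁻¹) atTop (𝓝 0) := by
      have := (tendsto_one_div_add_atTop_nhds_zero_nat (𝕜 := ℝ)).const_mul n
      simpa [one_div] using this
    have l1 : Tendsto (fun k => ∑ v, a (σ k) v * P v w - a (σ k) w) atTop
        (𝓝 (∑ v, c v * P v w - c w)) :=
      (tendsto_finsetSum _ fun v _ => (hlim v).mul_const _).sub (hlim w)
    have l2 : Tendsto (fun k => ∑ v, a (σ k) v * P v w - a (σ k) w) atTop (𝓝 0) :=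
      squeeze_zero_norm (fun k => hdiff (σ k)) (hz.comp hσ.tendsto_atTop)
    exact sub_eq_zero.1 (tendsto_nhds_unique l1 l2)
  · have l1 : Tendsto (fun k => ∑ v, a (σ k) v * f v) atTop (𝓝 (∑ v, c v * f v)) :=
      tendsto_finsetSum _ fun v _ => (hlim v).mul_const _
    have : ∀ k, ∑ v, a k v * f v = ∑ v, f v := fun k => by
      simp only [a, mul_assoc, ← Finset.mul_sum, Finset.sum_mul]
      rw [Finset.sum_comm, Finset.sum_congr rfl fun i _ => hf f hff i]
      simp only [Finset.sum_const, Finset.card_range, nsmul_eq_mul]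
      push_cast
      rw [inv_mul_cancel_left₀ (hk k).ne']
    simp only [this] at l1
    exact (tendsto_nhds_unique l1 tendsto_const_nhds)

end Stationary

/-! ### From invariance under a state to invariance in the algebra -/

section Rigidity

open scoped ComplexOrder

variable {A : Type*} [CStarAlgebra A] {X : Type*} [Fintype X] [DecidableEq X]

/-- If `u` is a right invertible corepresentation matrix with self-adjoint entries and the row
vector `c` is fixed by the matrix `φ(u)`, then `φ` does not see the difference of `c u` and `c`. -/
theorem IsState.apply_sq_sub_eq_zero {φ : A →ₗ[ℂ] ℂ} (hφ : IsState φ)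
    (Δ : A →⋆ₐ[ℂ] MinTensor A A) (u b : Matrix X X A) (hu : ∀ v w, star (u v w) = u v w)
    (hΔ : ∀ v w, Δ (u v w) = ∑ x, tmul (u v x) (u x w)) (hub : u * b = 1) (c : X → ℝ)
    (hc : ∀ w, φ (∑ v, (c v : ℂ) • u v w) = c w) (z : X) :
    φ (star (∑ v, (c v : ℂ) • u v z - (c z : ℂ) • 1) *
      (∑ v, (c v : ℂ) • u v z - (c z : ℂ) • 1)) = 0 := by
  set g : X → A := fun w => ∑ v, (c v : ℂ) • u v w with hg
  change ∀ w, φ (g w) = c w at hc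
  change φ (star (g z - (c z : ℂ) • 1) * (g z - (c z : ℂ) • 1)) = 0
  set a : X → A := fun w => g w - (c w : ℂ) • 1 with ha
  change φ (star (a z) * a z) = 0
  have hgs : ∀ w, star (g w) = g w := fun w => by
    simp [hg, star_sum, star_smul, hu]
  have hΔg : ∀ w, Δ (g w) = ∑ x, tmul (g x) (u x w) := fun w => by
    simp only [hg, map_sum, map_smul, hΔ, sum_tmul, smul_tmul, Finset.smul_sum]
    exact Finset.sum_comm
  -- The failure of `g` to be invariant, seen in the tensor square. It equals `∑ x, a x ⊗ u x w`,
  -- from which right invertibility of `u` recovers each `a z`.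
  let T : X → MinTensor A A := fun w => Δ (g w) - tmul 1 (g w)
  have hT : ∀ w, T w = ∑ x, tmul (a x) (u x w) := fun w => by
    simp only [T, hΔg, ha, sub_tmul, Finset.sum_sub_distrib, smul_tmul]
    congr 1
    simp only [hg, tmul_sum, tmul_smul]
  have hTs : ∀ w, star (T w) = T w := fun w => by
    simp only [T, star_sub, star_tmul, hgs, star_one, ← map_star]
  let m : A := ∑ w, g w * g w
  -- The constant of the two Cauchy–Schwarz estimates below: `Fintype.card X` for the square of a
  -- sum over `w`, and the norms of `a z ⊗ b w z` for the state.
  let K : ℝ := Fintype.card X * ∑ w, ‖(tmul (a z) (b w z) : MinTensor A A)‖ ^ 2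
  -- Here `ψ'` is the convolution `(φ ⊗ ψ) ∘ Δ`. The hypothesis `φ (g w) = c w` removes the cross
  -- terms, so the expectations of `T w⋆ T w` add up to `ψ' m - ψ m`: convolving with `φ` never
  -- decreases the value at `m`, and the increase controls `φ (a z⋆ a z)`.
  have step : ∀ ψ : {ψ : A →ₗ[ℂ] ℂ // IsState ψ}, ∃ ψ' : {ψ : A →ₗ[ℂ] ℂ // IsState ψ},
      ‖φ (star (a z) * a z)‖ ^ 2 ≤ K * ((ψ'.1 m).re - (ψ.1 m).re) := by
    rintro ⟨ψ, hψ⟩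
    obtain ⟨Ω, hΩ, ht⟩ := exists_isState_tensor hφ hψ
    refine ⟨⟨_, hΩ.comp Δ⟩, ?_⟩
    have h1 : ∀ w y, Ω (Δ (g w) * tmul 1 y) = ψ (g w * y) := fun w y => by
      simp only [hΔg, Finset.sum_mul, tmul_mul_tmul, mul_one, map_sum, ht, hc]
      simp [hg, Finset.sum_mul]
    have h2 : ∀ w y, Ω (tmul 1 y * Δ (g w)) = ψ (y * g w) := fun w y => by
      simp only [hΔg, Finset.mul_sum, tmul_mul_tmul, one_mul, map_sum, ht, hc]
      simp [hg, Finset.mul_sum]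
    have h3 : ∀ w, Ω (star (T w) * T w) = Ω (Δ (g w * g w)) - ψ (g w * g w) := fun w => by
      rw [hTs]
      simp only [T, sub_mul, mul_sub, map_sub, h1, h2, tmul_mul_tmul, ht, hφ.map_one, one_mul,
        map_mul]
      ring
    have h4 : ∑ w, (Ω (star (T w) * T w)).re = (Ω (Δ m)).re - (ψ m).re := by
      simp only [h3, m, map_sum, Complex.re_sum, Complex.sub_re, Finset.sum_sub_distrib]
    -- The adjoint of `u * b = 1` reads `∑ w, (b w z)⋆ u x w = δ_{xz}`, which isolates `a z` in the
    -- sum over `x`.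
    have h5 : φ (star (a z) * a z) = ∑ w, Ω (star (tmul (a z) (b w z)) * T w) := by
      have : ∑ w, star (tmul (a z) (b w z)) * T w = tmul (star (a z) * a z) (1 : A) := by
        simp only [hT, Finset.mul_sum, star_tmul, tmul_mul_tmul]
        rw [Finset.sum_comm]
        simp only [← tmul_sum]
        have hx : ∀ x, ∑ w, star (b w z) * u x w = if x = z then 1 else 0 := fun x => by
          have := congrArg star (congrFun (congrFun hub x) z)
          rw [Matrix.mul_apply, star_sum, Matrix.one_apply] at this
          simp only [star_mul, hu] at this
          rw [this]
          split_ifs <;> simp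
        simp only [hx]
        rw [Finset.sum_eq_single z]
        · simp
        · intro x _ hxz; simp [hxz, tmul_zero]
        · simp
      rw [← map_sum, this, ht, hψ.map_one, mul_one]
    have hnn : ∀ w, 0 ≤ (Ω (star (T w) * T w)).re := fun w => hΩ.re_nonneg _
    change _ ≤ K * ((Ω (Δ m)).re - (ψ m).re)
    rw [← h4, h5]
    calc _ ≤ (∑ w, ‖Ω (star (tmul (a z) (b w z)) * T w)‖) ^ 2 := by
          gcongr
          exact norm_sum_le _ _
      _ ≤ Fintype.card X * ∑ w, ‖Ω (star (tmul (a z) (b w z)) * T w)‖ ^ 2 :=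
          sq_sum_le_card_mul_sum_sq
      _ ≤ Fintype.card X * ∑ w, ‖(tmul (a z) (b w z) : MinTensor A A)‖ ^ 2 *
            ∑ w, (Ω (star (T w) * T w)).re := by
          gcongr with w
          refine (hΩ.norm_sq_le _ _).trans ?_
          refine mul_le_mul (hΩ.re_star_mul_self_le _) ?_ (hnn w) (by positivity)
          exact Finset.single_le_sum (f := fun w => (Ω (star (T w) * T w)).re)
            (fun i _ => hnn i) (Finset.mem_univ w)
      _ = K * ∑ w, (Ω (star (T w) * T w)).re := by
          simp only [← Finset.sum_mul, ← mul_assoc, K]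
  choose F hF using step
  -- Along the convolution powers of `φ` the real part of the value at `m` is bounded by `‖m‖`, yet
  -- it would grow at a constant rate if `φ (a z⋆ a z)` were nonzero.
  have := eq_zero_of_forall_le_mul_sub (s := fun k => ((F^[k] ⟨φ, hφ⟩).1 m).re) (M := ‖m‖)
    (d := ‖φ (star (a z) * a z)‖ ^ 2) (K := K) (by positivity) (by positivity)
    (fun k => (Complex.abs_re_le_norm _).trans ((F^[k] ⟨φ, hφ⟩).2.norm_le m))
    (fun k => by
      have := hF (F^[k] ⟨φ, hφ⟩)
      rwa [← Function.iterate_succ_apply' F] at this)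
  simpa using this

end Rigidity

/-! ### Column sums of a vertex action -/

section ColumnSums

open scoped ComplexOrder

variable {A : Type*} [CStarAlgebra A] {X : Type*} [Fintype X] [DecidableEq X]

/-- The Podleś condition says that `u` has dense range as a map of right modules. Hence some `u * M`
approximates the identity well enough to be invertible by a Neumann series. -/
theorem exists_mul_eq_one_of_dense (u : Matrix X X A)
    (hd : Dense (Submodule.span ℂ
      {F : X → A | ∃ (ξ : X → ℂ) (a : A), F = fun x => (∑ w, ξ w • u x w) * a} : Set (X → A))) :
    ∃ b : Matrix X X A, u * b = 1 := by
  have hspan : ∀ F ∈ Submodule.span ℂ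
      {F : X → A | ∃ (ξ : X → ℂ) (a : A), F = fun x => (∑ w, ξ w • u x w) * a},
      ∃ a : X → A, F = fun x => ∑ w, u x w * a w := by
    intro F hF
    induction hF using Submodule.span_induction with
    | mem F hF =>
      obtain ⟨ξ, a, rfl⟩ := hF
      refine ⟨fun w => ξ w • a, funext fun x => ?_⟩
      simp [Finset.sum_mul]
    | zero => exact ⟨0, by simp; rfl⟩
    | add F G _ _ hF hG =>
      obtain ⟨a, rfl⟩ := hF
      obtain ⟨b, rfl⟩ := hG
      exact ⟨a + b, funext fun x => by simp [mul_add, Finset.sum_add_distrib]⟩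
    | smul c F _ hF =>
      obtain ⟨a, rfl⟩ := hF
      exact ⟨c • a, funext fun x => by simp [Finset.smul_sum]⟩
  -- A row of `1 - u * M` has `Fintype.card X` entries of norm below `ε`, so its sum stays below one
  -- even after taking the maximum over rows.
  let ε : ℝ := ((Fintype.card X : ℝ) + 1)⁻¹
  have hε : 0 < ε := by positivity
  have happ : ∀ z, ∃ a : X → A, ∀ x, ‖(1 : Matrix X X A) x z - ∑ w, u x w * a w‖ < ε := by
    intro z
    obtain ⟨F, hF, hlt⟩ := Metric.mem_closure_iff.1 (hd (fun x => (1 : Matrix X X A) x z)) ε hε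
    obtain ⟨a, rfl⟩ := hspan F hF
    rw [dist_pi_lt_iff hε] at hlt
    exact ⟨a, fun x => by simpa [dist_eq_norm] using hlt x⟩
  choose a ha using happ
  let M : Matrix X X A := Matrix.of fun w z => a z w
  -- The maximal row sum makes the matrices a Banach algebra, with the completeness of the product
  -- space.
  let _ := Matrix.linftyOpNormedRing (n := X) (α := A)
  have : @CompleteSpace (Matrix X X A) PseudoMetricSpace.toUniformSpace :=
    inferInstanceAs (CompleteSpace (X → X → A))
  have hlt : ‖1 - u * M‖ < 1 := by
    have key : ∀ i, ∑ j, ‖(1 - u * M) i j‖₊ < 1 := fun i => by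
      rw [← NNReal.coe_lt_coe]
      push_cast
      calc ∑ j, ‖(1 - u * M) i j‖ ≤ ∑ _j : X, ε := Finset.sum_le_sum fun j _ => (ha j i).le
        _ = Fintype.card X * ε := by simp
        _ < 1 := by
          rw [← div_eq_mul_inv, div_lt_one (by positivity)]
          linarith
    rw [Matrix.linfty_opNorm_def, ← NNReal.coe_one, NNReal.coe_lt_coe,
      Finset.sup_lt_iff zero_lt_one]
    exact fun i _ => key i
  have hunit := isUnit_one_sub_of_norm_lt_one hlt
  rw [sub_sub_cancel] at hunit
  obtain ⟨y, hy⟩ := hunit.exists_right_inv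
  exact ⟨M * y, by rw [← mul_assoc, hy]⟩

theorem sum_eq_zero_of_star_mul_self {ι : Type*} [Fintype ι] (a : ι → A)
    (h : ∑ i, star (a i) * a i = 0) (i : ι) : a i = 0 := by
  let _ := CStarAlgebra.spectralOrder A
  have := CStarAlgebra.spectralOrderedRing A
  rw [Finset.sum_eq_zero_iff_of_nonneg fun i _ => star_mul_self_nonneg (a i)] at h
  exact (CStarRing.star_mul_self_eq_zero_iff _).1 (h i (Finset.mem_univ i))

/-- A right invertible corepresentation matrix whose rows are partitions of unity into projections
has columns that are partitions of unity as well. -/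
theorem sum_col_eq_one [Nontrivial A] (Δ : A →⋆ₐ[ℂ] MinTensor A A) (u : Matrix X X A)
    (hu : ∀ v w, star (u v w) = u v w)
    (hmul : ∀ v w w', u v w * u v w' = if w = w' then u v w else 0)
    (hrow : ∀ v, ∑ w, u v w = 1)
    (hΔ : ∀ v w, Δ (u v w) = ∑ x, tmul (u v x) (u x w)) (b : Matrix X X A) (hub : u * b = 1)
    (w : X) : ∑ v, u v w = 1 := by
  have hsq : ∀ v w, star (u v w) * u v w = u v w := fun v w => by rw [hu, hmul, if_pos rfl]
  -- All elements on which faithfulness of the state is needed are combinations of `1` and the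
  -- entries of `u`.
  let W : Submodule ℂ A := Submodule.span ℂ (insert 1 (Set.range fun p : X × X => u p.1 p.2))
  have : FiniteDimensional ℂ W :=
    FiniteDimensional.span_of_finite ℂ ((Set.finite_range _).insert 1)
  have huW : ∀ v w, u v w ∈ W := fun v w => Submodule.subset_span (.inr ⟨(v, w), rfl⟩)
  obtain ⟨φ, hφ, hfaith⟩ := exists_isState_faithful_on W
  let P : Matrix X X ℝ := Matrix.of fun v w => (φ (u v w)).re
  have hP : ∀ v w, φ (u v w) = (P v w : ℂ) := fun v w => by
    have := hφ.eq_ofReal_re (u v w)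
    rwa [hsq] at this
  have hP0 : ∀ v w, 0 ≤ P v w := fun v w => by
    have := hφ.re_nonneg (u v w)
    rwa [hsq] at this
  have hP1 : ∀ v, ∑ w, P v w = 1 := fun v => by
    have := congrArg Complex.re (congrArg φ (hrow v))
    simpa [hφ.map_one, P] using this
  obtain ⟨c, hc0, hcP, hcf⟩ := exists_stationary P hP0 hP1
  -- Rigidity: the difference of the two sides lies in `W` and has zero `φ`-norm.
  have hinv : ∀ w, ∑ v, (c v : ℂ) • u v w = (c w : ℂ) • 1 := fun w => by
    refine sub_eq_zero.1 (hfaith _ ?_ (hφ.apply_sq_sub_eq_zero Δ u b hu hΔ hub c (fun w => ?_) w))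
    · exact W.sub_mem (W.sum_mem fun v _ => W.smul_mem _ (huW v w))
        (W.smul_mem _ (Submodule.subset_span (.inl rfl)))
    · simp only [map_sum, map_smul, hP, smul_eq_mul, ← hcP w]
      push_cast
      rfl
  have hub' : ∀ v x, ∑ y, u v y * b y x = if v = x then 1 else 0 := fun v x => by
    have := congrFun (congrFun hub v) x
    rwa [Matrix.mul_apply, Matrix.one_apply] at this
  -- Evaluate `∑ v y', c v u v y u v y' b y' x` in two ways: orthogonality within row `v` and `c u =
  -- c` give the left side, `u * b = 1` gives the right side.
  have hb : ∀ y x, (c y : ℂ) • b y x = (c x : ℂ) • u x y := fun y x => by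
    have h1 : ∑ v, ∑ y', (c v : ℂ) • (u v y * u v y' * b y' x) = (c y : ℂ) • b y x := by
      have : ∀ v, ∑ y', (c v : ℂ) • (u v y * u v y' * b y' x) = ((c v : ℂ) • u v y) * b y x := by
        intro v
        rw [Finset.sum_eq_single y]
        · rw [hmul, if_pos rfl, smul_mul_assoc]
        · intro y' _ hne; rw [hmul, if_neg hne.symm, zero_mul, smul_zero]
        · simp
      simp only [this]
      rw [← Finset.sum_mul, hinv, smul_mul_assoc, one_mul]
    rw [← h1, Finset.sum_eq_single x]
    · rw [← Finset.smul_sum]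
      simp only [mul_assoc, ← Finset.mul_sum, hub', if_true, mul_one]
    · intro v _ hne
      rw [← Finset.smul_sum]
      simp only [mul_assoc, ← Finset.mul_sum, hub', if_neg hne, mul_zero, smul_zero]
    · simp
  -- In a column `w` with `c w = 0`, invariance makes a sum of positive elements `c v • u v w`
  -- vanish.
  have hz : ∀ v w, c v ≠ 0 → c w = 0 → u v w = 0 := fun v w hv hw => by
    have h1 := hinv w
    rw [hw, Complex.ofReal_zero, zero_smul] at h1
    have h2 := sum_eq_zero_of_star_mul_self (fun v => ((√(c v) : ℝ) : ℂ) • u v w) (by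
      rw [← h1]
      refine Finset.sum_congr rfl fun v _ => ?_
      rw [star_smul, smul_mul_smul_comm, hsq, RCLike.star_def, Complex.conj_ofReal,
        ← Complex.ofReal_mul, Real.mul_self_sqrt (hc0 v)]) v
    refine (smul_eq_zero.1 h2).resolve_left ?_
    exact Complex.ofReal_ne_zero.2 ((Real.sqrt_ne_zero (hc0 v)).2 hv)
  -- If `c x = 0`, then `b w x = 0` wherever `c w ≠ 0` by `hb`. So `1 = ∑ u x w * b w x` only
  -- involves `w` with `c w = 0`, and the sum of the corresponding projections `u x w` fixes `1`
  -- from the left.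
  have hzz : ∀ x, c x = 0 → ∑ w with c w = 0, u x w = 1 := fun x hx => by
    have h1 := hub' x x
    rw [if_pos rfl, ← Finset.sum_filter_add_sum_filter_not Finset.univ (fun w => c w = 0),
      Finset.sum_eq_zero (s := Finset.univ.filter fun w => ¬ c w = 0), add_zero] at h1
    · have h2 : (∑ w with c w = 0, u x w) * ∑ w with c w = 0, u x w * b w x =
          ∑ w with c w = 0, u x w * b w x := by
        rw [Finset.sum_mul_sum]
        refine Finset.sum_congr rfl fun y hy => ?_
        rw [Finset.sum_eq_single y]
        · rw [← mul_assoc, hmul, if_pos rfl]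
        · intro y' _ hne; rw [← mul_assoc, hmul, if_neg hne.symm, zero_mul]
        · exact fun h => absurd hy h
      rwa [h1, mul_one] at h2
    · intro w hw
      have h3 := hb w x
      rw [hx, Complex.ofReal_zero, zero_smul] at h3
      rw [(smul_eq_zero.1 h3).resolve_left
        (Complex.ofReal_ne_zero.2 (Finset.mem_filter.1 hw).2), mul_zero]
  -- By `hz` and `hzz` the indicator of the zero set of `c` is harmonic. Its pairing with `c` is
  -- zero and equals its pairing with the counting measure, so the zero set is empty.
  have hpos : ∀ x, c x ≠ 0 := by
    have h1 := hcf (fun x => if c x = 0 then 1 else 0) (fun v => by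
      simp only [mul_ite, mul_one, mul_zero, ← Finset.sum_filter]
      split_ifs with hv
      · have := congrArg Complex.re (congrArg φ (hzz v hv))
        simpa [hφ.map_one, P] using this
      · refine Finset.sum_eq_zero fun w hw => ?_
        simp [P, hz v w hv (Finset.mem_filter.1 hw).2])
    rw [Finset.sum_eq_zero (fun x _ => by simp)] at h1
    intro x hx
    have h2 := (Finset.sum_eq_zero_iff_of_nonneg (fun x _ => by split_ifs <;> norm_num)).1 h1.symm x
      (Finset.mem_univ x)
    simp [hx] at h2
  -- With `c` invertible, `hb` expresses `b` through `u`; multiplying the diagonal entry of `u * b =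
  -- 1` by `u v y` compares `c v` with `c y` wherever `u v y ≠ 0`.
  have hcu : ∀ v y, (c v : ℂ) • u v y = (c y : ℂ) • u v y := fun v y => by
    have hb' : ∀ y, b y v = ((c y : ℂ)⁻¹ * c v) • u v y := fun y => by
      rw [mul_smul, ← hb, smul_smul, inv_mul_cancel₀ (Complex.ofReal_ne_zero.2 (hpos y)), one_smul]
    have h1 := congrArg (u v y * ·) (hub' v v)
    simp only [if_true, mul_one, Finset.mul_sum, ← mul_assoc] at h1
    rw [Finset.sum_eq_single y] at h1
    · rw [hmul, if_pos rfl, hb', mul_smul_comm, hmul, if_pos rfl, mul_smul] at h1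
      rw [← smul_inv_smul₀ (Complex.ofReal_ne_zero.2 (hpos y)) ((c v : ℂ) • u v y), h1]
    · intro y' _ hne; rw [hmul, if_neg hne.symm, zero_mul]
    · simp
  have h1 := hinv w
  simp only [hcu _ w, ← Finset.smul_sum] at h1
  exact smul_right_injective A (Complex.ofReal_ne_zero.2 (hpos w)) h1

end ColumnSums

/-! ### Completion of a ⋆-algebra in a C⋆-seminorm -/

section EnvelopingCStarAlgebra

open UniformSpace UniformSpace.Completion

/-- A ⋆-algebra with a C⋆-seminorm. -/
class PreCStarAlgebra (S : Type*) extends SeminormedRing S, StarRing S, NormedAlgebra ℂ S,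
    StarModule ℂ S where
  norm_mul_self_le : ∀ s : S, ‖s‖ * ‖s‖ ≤ ‖star s * s‖

variable (S : Type u) [PreCStarAlgebra S]

instance : NormedStarGroup S := ⟨fun t => by
  rcases (norm_nonneg (star t)).eq_or_lt with h | h
  · rw [← h]; exact norm_nonneg _
  · have := (PreCStarAlgebra.norm_mul_self_le (star t)).trans (norm_mul_le _ _)
    rw [star_star] at this
    exact le_of_mul_le_mul_right this h⟩

/-- The Hausdorff completion of a ⋆-algebra in a C⋆-seminorm. -/
def CStarCompletion : Type u := Completion S

namespace CStarCompletion

noncomputable instance : NormedRing (CStarCompletion S) :=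
  inferInstanceAs (NormedRing (Completion S))
noncomputable instance : CompleteSpace (CStarCompletion S) :=
  inferInstanceAs (CompleteSpace (Completion S))
noncomputable instance : Algebra ℂ (CStarCompletion S) :=
  inferInstanceAs (Algebra ℂ (Completion S))
noncomputable instance : NormedAlgebra ℂ (CStarCompletion S) where
  norm_smul_le := norm_smul_le (α := ℂ) (β := Completion S)

noncomputable instance : Star (CStarCompletion S) where
  star := Completion.map (star : S → S)

variable {S}

/-- The canonical map into the completion. -/
noncomputable def ofAlgHom : S →ₐ[ℂ] CStarCompletion S where
  toFun s := (s : Completion S)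
  map_one' := coe_one _
  map_zero' := coe_zero
  map_mul' := coe_mul
  map_add' := coe_add
  commutes' _ := rfl

theorem norm_of (s : S) : ‖ofAlgHom s‖ = ‖s‖ := norm_coe s

theorem denseRange_of : DenseRange (ofAlgHom : S → CStarCompletion S) := denseRange_coe

theorem continuous_star_completion : Continuous (star : CStarCompletion S → CStarCompletion S) :=
  continuous_map

theorem star_of (s : S) : star (ofAlgHom s) = ofAlgHom (star s) :=
  map_coe star_isometry.uniformContinuous s

noncomputable instance : StarRing (CStarCompletion S) where
  star_involutive x := by
    refine denseRange_of.induction_on (p := fun x => star (star x) = x) x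
      (isClosed_eq (continuous_star_completion.comp continuous_star_completion) continuous_id)
      fun t => ?_
    rw [star_of, star_of, star_star]
  star_mul x y := by
    refine denseRange_of.induction_on₂ (p := fun x y => star (x * y) = star y * star x)
      (isClosed_eq (continuous_star_completion.comp continuous_mul)
        ((continuous_star_completion.comp continuous_snd).mul
          (continuous_star_completion.comp continuous_fst))) (fun s t => ?_) x y
    rw [← map_mul, star_of, star_of, star_of, star_mul, map_mul]
  star_add x y := by
    refine denseRange_of.induction_on₂ (p := fun x y => star (x + y) = star x + star y)
      (isClosed_eq (continuous_star_completion.comp continuous_add)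
        ((continuous_star_completion.comp continuous_fst).add
          (continuous_star_completion.comp continuous_snd))) (fun s t => ?_) x y
    rw [← map_add, star_of, star_of, star_of, star_add, map_add]

instance : StarModule ℂ (CStarCompletion S) where
  star_smul c x := by
    refine denseRange_of.induction_on (p := fun x => star (c • x) = star c • star x) x
      (isClosed_eq (continuous_star_completion.comp (continuous_const_smul c))
        (continuous_star_completion.const_smul (star c))) fun t => ?_
    rw [← map_smul, star_of, star_of, star_smul, map_smul]

instance : CStarRing (CStarCompletion S) where
  norm_mul_self_le x := by
    refine denseRange_of.induction_on (p := fun x => ‖x‖ * ‖x‖ ≤ ‖star x * x‖) x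
      (isClosed_le (continuous_norm.mul continuous_norm)
        (continuous_norm.comp (continuous_star_completion.mul continuous_id))) fun t => ?_
    rw [star_of, ← map_mul, norm_of, norm_of]
    exact PreCStarAlgebra.norm_mul_self_le t

noncomputable instance : CStarAlgebra (CStarCompletion S) where

theorem exists_lift {B : Type*} [CStarAlgebra B] (f : S →⋆ₐ[ℂ] B) (hf : ∀ s, ‖f s‖ ≤ ‖s‖) :
    ∃ g : CStarCompletion S →⋆ₐ[ℂ] B, ∀ s, g (ofAlgHom s) = f s := by
  have hfc : Continuous f := (AddMonoidHomClass.lipschitz_of_bound f 1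
    (fun s => by simpa using hf s)).continuous
  let g : CStarCompletion S →+* B := extensionHom (f : S →+* B) hfc
  have hg : ∀ s : S, g (ofAlgHom s) = f s := extensionHom_coe (f : S →+* B) hfc
  have hgc : Continuous g := continuous_extension
  refine ⟨{ g with
    commutes' := fun c => ((congrArg g (ofAlgHom.commutes c).symm).trans (hg _)).trans (f.commutes c)
    map_star' := fun x => ?_ }, hg⟩
  refine denseRange_of.induction_on (p := fun x => g (star x) = star (g x)) x
    (isClosed_eq (hgc.comp continuous_star_completion) (continuous_star.comp hgc)) fun t => ?_
  rw [star_of, hg, hg, map_star]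

end CStarCompletion

end EnvelopingCStarAlgebra

/-! ### Universal C⋆-algebras by generators and relations -/

section Universal

/-- The free ⋆-algebra on self-adjoint generators. -/
def FreeStarAlgebra (X : Type u) : Type u := FreeAlgebra ℂ X

namespace FreeStarAlgebra

variable {X : Type u}

noncomputable instance : Ring (FreeStarAlgebra X) := inferInstanceAs (Ring (FreeAlgebra ℂ X))
noncomputable instance : Algebra ℂ (FreeStarAlgebra X) :=
  inferInstanceAs (Algebra ℂ (FreeAlgebra ℂ X))

/-- The generators. -/
noncomputable def gen (x : X) : FreeStarAlgebra X := FreeAlgebra.ι ℂ x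

/-- The homomorphism with given values on the generators. -/
noncomputable def lift {B : Type*} [Ring B] [Algebra ℂ B] (b : X → B) :
    FreeStarAlgebra X →ₐ[ℂ] B := FreeAlgebra.lift ℂ b

theorem lift_gen {B : Type*} [Ring B] [Algebra ℂ B] (b : X → B) (x : X) :
    lift b (gen x) = b x := FreeAlgebra.lift_ι_apply b x

theorem induction {C : FreeStarAlgebra X → Prop} (scalar : ∀ c, C (algebraMap ℂ _ c))
    (gen : ∀ x, C (gen x)) (mul : ∀ a b, C a → C b → C (a * b))
    (add : ∀ a b, C a → C b → C (a + b)) (a : FreeStarAlgebra X) : C a :=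
  FreeAlgebra.induction ℂ X (motive := C) scalar gen mul add a

/-- The opposite algebra with the conjugate scalar multiplication. -/
def ConjOpposite (X : Type u) : Type u := (FreeStarAlgebra X)ᵐᵒᵖ

noncomputable instance : Ring (ConjOpposite X) := inferInstanceAs (Ring (FreeStarAlgebra X)ᵐᵒᵖ)
-- Scalars act through conjugation, so that a conjugate-linear antiautomorphism becomes an algebra
-- homomorphism and can be obtained from freeness.
noncomputable instance : Algebra ℂ (ConjOpposite X) :=
  Algebra.compHom (FreeStarAlgebra X)ᵐᵒᵖ (starRingEnd ℂ)

/-- The involution, as a homomorphism to the conjugate opposite algebra. -/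
noncomputable def conjStarHom : FreeStarAlgebra X →ₐ[ℂ] ConjOpposite X :=
  lift (B := ConjOpposite X) fun x => MulOpposite.op (gen x)

/-- The involution, as a ring homomorphism to the opposite ring. -/
noncomputable def starHom : FreeStarAlgebra X →+* (FreeStarAlgebra X)ᵐᵒᵖ where
  toFun a := conjStarHom a
  map_one' := map_one conjStarHom
  map_zero' := map_zero conjStarHom
  map_mul' := map_mul conjStarHom
  map_add' := map_add conjStarHom

theorem starHom_gen (x : X) : starHom (gen x) = MulOpposite.op (gen x) :=
  lift_gen (B := ConjOpposite X) _ x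

theorem starHom_algebraMap (c : ℂ) : starHom (algebraMap ℂ (FreeStarAlgebra X) c) =
    MulOpposite.op (algebraMap ℂ _ (star c)) := (conjStarHom (X := X)).commutes c

noncomputable instance : StarRing (FreeStarAlgebra X) where
  star a := (starHom a).unop
  star_involutive a := by
    refine induction (C := fun a => (starHom (starHom a).unop).unop = a) (fun c => ?_)
      (fun x => ?_) (fun a b ha hb => ?_) (fun a b ha hb => ?_) a
    · simp [starHom_algebraMap]
    · simp [starHom_gen]
    · simp [ha, hb]
    · simp [ha, hb]
  star_mul a b := by simp
  star_add a b := by simp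

theorem star_def (a : FreeStarAlgebra X) : star a = (starHom a).unop := rfl

instance : StarModule ℂ (FreeStarAlgebra X) where
  star_smul c a := by
    simp [star_def, Algebra.smul_def, starHom_algebraMap, Algebra.commutes]

theorem lift_star {B : Type*} [CStarAlgebra B] {b : X → B} (hb : ∀ x, star (b x) = b x)
    (a : FreeStarAlgebra X) : lift b (star a) = star (lift b a) := by
  refine induction (C := fun a => lift b (star a) = star (lift b a)) (fun c => ?_)
    (fun x => ?_) (fun a b ha hb => ?_) (fun a b ha hb => ?_) a
  · rw [star_def, starHom_algebraMap, MulOpposite.unop_op, AlgHom.commutes, AlgHom.commutes,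
      algebraMap_star_comm]
  · rw [star_def, starHom_gen, MulOpposite.unop_op, lift_gen, hb]
  · rw [star_mul, map_mul, map_mul, star_mul, ha, hb]
  · rw [star_add, map_add, map_add, star_add, ha, hb]

/-- The homomorphism to a C⋆-algebra with given self-adjoint values on the generators. -/
noncomputable def liftStar {B : Type*} [CStarAlgebra B] {b : X → B} (hb : ∀ x, star (b x) = b x) :
    FreeStarAlgebra X →⋆ₐ[ℂ] B := { lift b with map_star' := lift_star hb }

/-- By induction on the polynomial, with a bound uniform over all representations; this makes the
supremum defining the universal seminorm finite. -/
theorem exists_norm_lift_le (R : ∀ (B : Type u) [CStarAlgebra B], (X → B) → Prop)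
    (hR : ∀ (B : Type u) [CStarAlgebra B] (b : X → B), R B b → ∀ x, ‖b x‖ ≤ 1)
    (a : FreeStarAlgebra X) :
    ∃ M : ℝ, ∀ (B : Type u) [CStarAlgebra B] (b : X → B), R B b → ‖lift b a‖ ≤ M := by
  refine induction (C := fun a => ∃ M : ℝ, ∀ (B : Type u) [CStarAlgebra B] (b : X → B), R B b →
    ‖lift b a‖ ≤ M) (fun c => ⟨‖c‖, fun B _ b _ => ?_⟩) (fun x => ⟨1, fun B _ b h => ?_⟩)
    (fun a a' ⟨M, hM⟩ ⟨M', hM'⟩ => ⟨M * M', fun B _ b h => ?_⟩)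
    (fun a a' ⟨M, hM⟩ ⟨M', hM'⟩ => ⟨M + M', fun B _ b h => ?_⟩) a
  · rw [AlgHom.commutes]
    rcases subsingleton_or_nontrivial B with hB | hB
    · rw [Subsingleton.elim (algebraMap ℂ B c) 0, norm_zero]
      exact norm_nonneg c
    · rw [norm_algebraMap']
  · rw [lift_gen]
    exact hR B b h x
  · rw [map_mul]
    exact (norm_mul_le _ _).trans (mul_le_mul (hM B b h) (hM' B b h) (norm_nonneg _)
      ((norm_nonneg _).trans (hM B b h)))
  · rw [map_add]
    exact (norm_add_le _ _).trans (add_le_add (hM B b h) (hM' B b h))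

end FreeStarAlgebra

open FreeStarAlgebra in
/-- The universal C⋆-algebra on self-adjoint contractions satisfying the relations `R`. -/
theorem exists_universal_cstarAlgebra {X : Type u}
    (R : ∀ (B : Type u) [CStarAlgebra B], (X → B) → Prop)
    (hstar : ∀ (B : Type u) [CStarAlgebra B] (b : X → B), R B b → ∀ x, star (b x) = b x)
    (hnorm : ∀ (B : Type u) [CStarAlgebra B] (b : X → B), R B b → ∀ x, ‖b x‖ ≤ 1) :
    ∃ (A : Type u) (_ : CStarAlgebra A) (a : X → A), (∀ x, star (a x) = a x) ∧
      Dense (Algebra.adjoin ℂ (Set.range a) : Set A) ∧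
      (∀ p : FreeStarAlgebra X, (∀ (B : Type u) [CStarAlgebra B] (b : X → B), R B b →
        lift b p = 0) → lift a p = 0) ∧
      ∀ (B : Type u) [CStarAlgebra B] (b : X → B), R B b →
        ∃ f : A →⋆ₐ[ℂ] B, ∀ x, f (a x) = b x := by
  -- Only the values of the norms are collected, so ranging over all C⋆-algebras of the universe
  -- still yields a set of reals.
  let N : FreeStarAlgebra X → Set ℝ := fun p =>
    {r | ∃ (B : Type u) (_ : CStarAlgebra B) (b : X → B), R B b ∧ r = ‖lift b p‖}
  have hbdd : ∀ p, BddAbove (N p) := fun p => by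
    obtain ⟨M, hM⟩ := exists_norm_lift_le R hnorm p
    exact ⟨M, by rintro r ⟨B, _, b, hb, rfl⟩; exact hM B b hb⟩
  let n : FreeStarAlgebra X → ℝ := fun p => sSup (N p)
  have hle : ∀ (B : Type u) [CStarAlgebra B] (b : X → B), R B b → ∀ p, ‖lift b p‖ ≤ n p :=
    fun B _ b hb p => le_csSup (hbdd p) ⟨B, _, b, hb, rfl⟩
  have hn0 : ∀ p, 0 ≤ n p := fun p =>
    Real.sSup_nonneg (by rintro r ⟨B, _, b, hb, rfl⟩; exact norm_nonneg _)
  have hn : ∀ p (c : ℝ), 0 ≤ c → (∀ (B : Type u) [CStarAlgebra B] (b : X → B), R B b →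
      ‖lift b p‖ ≤ c) → n p ≤ c := fun p c hc H =>
    Real.sSup_le (by rintro r ⟨B, _, b, hb, rfl⟩; exact H B b hb) hc
  let sn : RingSeminorm (FreeStarAlgebra X) :=
    { toFun := n
      map_zero' := le_antisymm (hn 0 0 le_rfl fun B _ b _ => by simp) (hn0 0)
      add_le' := fun p q => hn _ _ (add_nonneg (hn0 p) (hn0 q)) fun B _ b hb => by
        rw [map_add]
        exact (norm_add_le _ _).trans (add_le_add (hle B b hb p) (hle B b hb q))
      neg' := fun p => by
        change sSup (N (-p)) = sSup (N p)
        simp only [N, map_neg, norm_neg]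
      mul_le' := fun p q => hn _ _ (mul_nonneg (hn0 p) (hn0 q)) fun B _ b hb => by
        rw [map_mul]
        exact (norm_mul_le _ _).trans
          (mul_le_mul (hle B b hb p) (hle B b hb q) (norm_nonneg _) (hn0 p)) }
  let _ : PreCStarAlgebra (FreeStarAlgebra X) :=
    { sn.toAddGroupSeminorm.toSeminormedAddCommGroup, (inferInstance : Ring (FreeStarAlgebra X)),
      (inferInstance : StarRing (FreeStarAlgebra X)),
      (inferInstance : Algebra ℂ (FreeStarAlgebra X)),
      (inferInstance : StarModule ℂ (FreeStarAlgebra X)) with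
      norm_mul_le := sn.mul_le'
      norm_smul_le := fun c p => hn _ _ (mul_nonneg (norm_nonneg c) (hn0 p)) fun B _ b hb => by
        rw [map_smul, norm_smul]
        exact mul_le_mul_of_nonneg_left (hle B b hb p) (norm_nonneg c)
      norm_mul_self_le := fun p => by
        -- Each representation respects the involution, as the generators go to self-adjoint
        -- elements; hence the C⋆-identity passes to the supremum.
        have h1 : n p ≤ √(n (star p * p)) := hn _ _ (Real.sqrt_nonneg _) fun B _ b hb => by
          refine Real.le_sqrt_of_sq_le ?_
          rw [sq, ← CStarRing.norm_star_mul_self, ← lift_star (hstar B b hb), ← map_mul]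
          exact hle B b hb _
        calc n p * n p ≤ √(n (star p * p)) * √(n (star p * p)) :=
              mul_self_le_mul_self (hn0 p) h1
          _ = _ := Real.mul_self_sqrt (hn0 _) }
  let a : X → CStarCompletion (FreeStarAlgebra X) := fun x => CStarCompletion.ofAlgHom (gen x)
  have ha : ∀ p, lift a p = CStarCompletion.ofAlgHom p := fun p =>
    induction (C := fun p => lift a p = CStarCompletion.ofAlgHom p)
      (fun c => by rw [AlgHom.commutes, AlgHom.commutes]) (fun x => lift_gen a x)
      (fun p q hp hq => by rw [map_mul, map_mul, hp, hq])
      (fun p q hp hq => by rw [map_add, map_add, hp, hq]) p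
  refine ⟨CStarCompletion (FreeStarAlgebra X), inferInstance, a, fun x => ?_, ?_, fun p hp => ?_,
    fun B _ b hb => ?_⟩
  · rw [CStarCompletion.star_of, star_def, starHom_gen]
    rfl
  · refine (CStarCompletion.denseRange_of (S := FreeStarAlgebra X)).mono ?_
    rintro _ ⟨p, rfl⟩
    refine induction (C := fun p => CStarCompletion.ofAlgHom p ∈ Algebra.adjoin ℂ (Set.range a))
      (fun c => ?_) (fun x => Algebra.subset_adjoin ⟨x, rfl⟩)
      (fun p q hp hq => ?_) (fun p q hp hq => ?_) p
    · rw [AlgHom.commutes]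
      exact Subalgebra.algebraMap_mem _ c
    · rw [map_mul]
      exact mul_mem hp hq
    · rw [map_add]
      exact add_mem hp hq
  · rw [ha, ← norm_eq_zero, CStarCompletion.norm_of]
    exact le_antisymm (hn p 0 le_rfl fun B _ b hb => by rw [hp B b hb, norm_zero]) (hn0 p)
  · obtain ⟨g, hg⟩ := CStarCompletion.exists_lift (liftStar (hstar B b hb)) (hle B b hb)
    exact ⟨g, fun x => (hg _).trans (lift_gen b x)⟩

end Universal

/-! ### Arguments on dense subalgebras -/

section DenseSubalgebras

open scoped CStarAlgebra

variable {A : Type*} [CStarAlgebra A]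

theorem Subalgebra.mem_of_dense_adjoin {S : Set A} (hS : Dense (Algebra.adjoin ℂ S : Set A))
    (K : Subalgebra ℂ A) (hK : IsClosed (K : Set A)) (h : S ⊆ K) (a : A) : a ∈ K :=
  hK.closure_subset_iff.2 (SetLike.coe_subset_coe.2 (Algebra.adjoin_le h)) (hS a)

theorem StarAlgHom.eq_of_dense_adjoin {B : Type*} [CStarAlgebra B] {S : Set A}
    (hS : Dense (Algebra.adjoin ℂ S : Set A)) (f g : A →⋆ₐ[ℂ] B) (h : ∀ s ∈ S, f s = g s) :
    f = g := by
  ext a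
  exact Subalgebra.mem_of_dense_adjoin hS (AlgHom.equalizer f.toAlgHom g.toAlgHom)
    (isClosed_eq (map_continuous f) (map_continuous g)) h a

/-- If `i` and `j` are commuting homomorphisms and the closed span `T` of `Δ(A) j(A)` contains
`i(s)` for all `s` in a generating set, then `T` contains all `i(a) j(b)`. -/
theorem mul_mem_closure_span_of_generators {M : Type*} [CStarAlgebra M] {S : Set A}
    (hS : Dense (Algebra.adjoin ℂ S : Set A)) (Δ i j : A →⋆ₐ[ℂ] M)
    (hij : ∀ a b, i a * j b = j b * i a)
    (hi : ∀ s ∈ S, i s ∈ (Submodule.span ℂ {x | ∃ a b, x = Δ a * j b}).topologicalClosure)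
    (a b : A) : i a * j b ∈ (Submodule.span ℂ {x | ∃ a b, x = Δ a * j b}).topologicalClosure := by
  set T := (Submodule.span ℂ {x | ∃ a b, x = Δ a * j b}).topologicalClosure with hT
  have hTc : IsClosed (T : Set M) := Submodule.isClosed_topologicalClosure _
  have hgen : ∀ a b, Δ a * j b ∈ T := fun a b =>
    Submodule.le_topologicalClosure _ (Submodule.subset_span ⟨a, b, rfl⟩)
  have hind : ∀ L : M →L[ℂ] M, (∀ a b, L (Δ a * j b) ∈ T) → ∀ t ∈ T, L t ∈ T := fun L hL t ht => by
    have : (Submodule.span ℂ {x | ∃ a b, x = Δ a * j b}).topologicalClosure ≤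
        T.comap (L : M →ₗ[ℂ] M) :=
      Submodule.topologicalClosure_minimal _
        (Submodule.span_le.2 (by rintro _ ⟨a, b, rfl⟩; exact hL a b)) (hTc.preimage L.continuous)
    exact this ht
  have hright : ∀ t ∈ T, ∀ b, t * j b ∈ T := fun t ht b =>
    hind ((ContinuousLinearMap.mul ℂ M).flip (j b)) (fun a b' => by
      have := hgen a (b' * b)
      rwa [map_mul, ← mul_assoc] at this) t ht
  have hleft : ∀ t ∈ T, ∀ a, Δ a * t ∈ T := fun t ht a =>
    hind (ContinuousLinearMap.mul ℂ M (Δ a)) (fun a' b => by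
      have := hgen (a * a') b
      rwa [map_mul, mul_assoc] at this) t ht
  -- Since `i` and `j` commute, `Δ a' * j b * i a = Δ a' * i a * j b`, and `T` is stable under `Δ`
  -- on the left and `j` on the right. Hence the `a` with `i a ∈ T` form a closed subalgebra, and
  -- generators suffice.
  have hmul : ∀ t ∈ T, ∀ a, i a ∈ T → t * i a ∈ T := fun t ht a ha =>
    hind ((ContinuousLinearMap.mul ℂ M).flip (i a)) (fun a' b => by
      change Δ a' * j b * i a ∈ T
      rw [mul_assoc, ← hij, ← mul_assoc]
      exact hright _ (hleft _ ha a') b) t ht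
  have hone : i 1 ∈ T := by
    have := hgen 1 1
    rwa [map_one, map_one, mul_one, ← map_one i] at this
  let K : Subalgebra ℂ A :=
    { carrier := {a | i a ∈ T}
      mul_mem' := fun {x y} hx hy => by
        change i (x * y) ∈ T
        rw [map_mul]
        exact hmul _ hx _ hy
      add_mem' := fun {x y} hx hy => by
        change i (x + y) ∈ T
        rw [map_add]
        exact T.add_mem hx hy
      algebraMap_mem' := fun c => by
        change i (algebraMap ℂ A c) ∈ T
        rw [Algebra.algebraMap_eq_smul_one, map_smul]
        exact T.smul_mem c hone }
  exact hright _ (Subalgebra.mem_of_dense_adjoin hS K (hTc.preimage (map_continuous i)) hi a) b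

end DenseSubalgebras

/-! ### The two legs of the tensor product and the associativity graph -/

namespace CStarTensor

open scoped TensorProduct

variable {A B C : Type*} [CStarAlgebra A] [CStarAlgebra B] [CStarAlgebra C]

/-- The embedding `a ↦ a ⊗ 1`. -/
noncomputable def inclLeft : A →⋆ₐ[ℂ] MinTensor A B where
  toFun a := tmul a 1
  map_one' := one_tmul_one
  map_mul' a a' := by rw [tmul_mul_tmul, one_mul]
  map_zero' := zero_tmul 1
  map_add' a a' := add_tmul a a' 1
  commutes' c := by
    rw [Algebra.algebraMap_eq_smul_one, Algebra.algebraMap_eq_smul_one, smul_tmul, one_tmul_one]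
  map_star' a := by rw [star_tmul, star_one]

/-- The embedding `b ↦ 1 ⊗ b`. -/
noncomputable def inclRight : B →⋆ₐ[ℂ] MinTensor A B where
  toFun b := tmul 1 b
  map_one' := one_tmul_one
  map_mul' a a' := by rw [tmul_mul_tmul, one_mul]
  map_zero' := tmul_zero 1
  map_add' a a' := tmul_add 1 a a'
  commutes' c := by
    rw [Algebra.algebraMap_eq_smul_one, Algebra.algebraMap_eq_smul_one, tmul_smul, one_tmul_one]
  map_star' a := by rw [star_tmul, star_one]

theorem inclLeft_apply (a : A) : (inclLeft a : MinTensor A B) = tmul a 1 := rfl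

theorem inclRight_apply (b : B) : (inclRight b : MinTensor A B) = tmul 1 b := rfl

theorem mem_of_tmul_mem (T : Submodule ℂ (MinTensor A B)) (hT : IsClosed (T : Set (MinTensor A B)))
    (h : ∀ a b, tmul a b ∈ T) (x : MinTensor A B) : x ∈ T := by
  refine denseRange_incl.induction_on (p := fun x => x ∈ T) x hT fun t => ?_
  change incl (A := A) (B := B) (t : A ⊗[ℂ] B) ∈ T
  obtain ⟨n, a, b, h'⟩ := exists_sum_tmul (show A ⊗[ℂ] B from t)
  have : incl t = ∑ k, tmul (a k) (b k) := (congrArg incl h').trans (map_sum incl _ _)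
  rw [this]
  exact T.sum_mem fun k _ => h _ _

/-- The graph of the associativity isomorphism, as a closed subalgebra. -/
noncomputable def assocSubalgebra (A B C : Type*) [CStarAlgebra A] [CStarAlgebra B]
    [CStarAlgebra C] :
    Subalgebra ℂ (MinTensor (MinTensor A B) C × MinTensor A (MinTensor B C)) :=
  (Algebra.adjoin ℂ {p | ∃ a b c, p = (tmul (tmul a b) c, tmul a (tmul b c))}).topologicalClosure

/-- The elementary pairs are closed under multiplication, so their span is already an algebra. This
reduces coassociativity to generators. -/
theorem mem_assocSubalgebra {p : MinTensor (MinTensor A B) C × MinTensor A (MinTensor B C)} :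
    p ∈ assocSubalgebra A B C ↔ p ∈ assocGraph A B C := by
  let M : Submonoid (MinTensor (MinTensor A B) C × MinTensor A (MinTensor B C)) :=
    { carrier := {p | ∃ a b c, p = (tmul (tmul a b) c, tmul a (tmul b c))}
      one_mem' := ⟨1, 1, 1, by simp only [one_tmul_one]; rfl⟩
      mul_mem' := by
        rintro _ _ ⟨a, b, c, rfl⟩ ⟨a', b', c', rfl⟩
        exact ⟨a * a', b * b', c * c', by rw [Prod.mk_mul_mk]; simp only [tmul_mul_tmul]⟩ }
  let s : Set (MinTensor (MinTensor A B) C × MinTensor A (MinTensor B C)) := M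
  have h : Subalgebra.toSubmodule (Algebra.adjoin ℂ s) = Submodule.span ℂ s := by
    rw [Algebra.adjoin_eq_span, Submonoid.closure_eq]
  change p ∈ (Subalgebra.toSubmodule (Algebra.adjoin ℂ s)).topologicalClosure ↔
    p ∈ (Submodule.span ℂ s).topologicalClosure
  rw [h]

end CStarTensor

/-! ### Partitions of unity into projections -/

section Projections

variable {A : Type*} [CStarAlgebra A]

/-- Compressing `∑ p k = 1` by `p j` and cancelling `p j` leaves `∑ (p k p j)⋆ (p k p j) = 0` over
`k ≠ j`, a vanishing sum of positive elements. -/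
theorem mul_eq_zero_of_sum_eq_one {ι : Type*} [Fintype ι] [DecidableEq ι] (p : ι → A)
    (hstar : ∀ i, star (p i) = p i) (hsq : ∀ i, p i * p i = p i) (hsum : ∑ i, p i = 1) {i j : ι}
    (hij : i ≠ j) : p i * p j = 0 := by
  have h1 : ∑ k, p j * p k * p j = p j := by
    rw [← Finset.sum_mul, ← Finset.mul_sum, hsum, mul_one, hsq]
  rw [← Finset.add_sum_erase _ _ (Finset.mem_univ j), hsq, hsq, add_eq_left] at h1
  have h2 := sum_eq_zero_of_star_mul_self (fun k => if k = j then 0 else p k * p j) (by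
    rw [← Finset.add_sum_erase _ _ (Finset.mem_univ j), if_pos rfl, star_zero, zero_mul, zero_add,
      ← h1]
    refine Finset.sum_congr rfl fun k hk => ?_
    rw [if_neg (Finset.ne_of_mem_erase hk), star_mul, hstar, hstar, mul_assoc, ← mul_assoc (p k),
      hsq, mul_assoc]) i
  simpa [hij] using h2

theorem norm_le_one_of_mul_self {p : A} (hstar : star p = p) (hsq : p * p = p) : ‖p‖ ≤ 1 := by
  have h := CStarRing.norm_star_mul_self (x := p)
  rw [hstar, hsq] at h
  nlinarith [norm_nonneg p]

end Projections

/-! ### Banica's quantum automorphism group as a compact quantum group -/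

namespace DirectedGraph

section BanicaRelations

variable {V : Type v} {E : Type w} [Fintype V] [DecidableEq V] [Fintype E]
  (𝒢 : DirectedGraph V E)

/-- The entries of the adjacency matrix as scalars. -/
def adjCoeff (v w : V) : ℂ := if ∃ e, 𝒢.s e = v ∧ 𝒢.r e = w then 1 else 0

variable {𝒢}

omit [Fintype V] in
theorem adjCoeff_edge (e : E) : 𝒢.adjCoeff (𝒢.s e) (𝒢.r e) = 1 := if_pos ⟨e, rfl, rfl⟩

theorem mul_adjacency_apply {A : Type*} [CStarAlgebra A] (q : Matrix V V A) (v w : V) :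
    (q * 𝒢.adjacency A) v w = ∑ x, 𝒢.adjCoeff x w • q v x := by
  rw [Matrix.mul_apply]
  refine Finset.sum_congr rfl fun x _ => ?_
  rw [adjacency, Matrix.of_apply, adjCoeff]
  split_ifs <;> simp

theorem adjacency_mul_apply {A : Type*} [CStarAlgebra A] (q : Matrix V V A) (v w : V) :
    (𝒢.adjacency A * q) v w = ∑ x, 𝒢.adjCoeff v x • q x w := by
  rw [Matrix.mul_apply]
  refine Finset.sum_congr rfl fun x _ => ?_
  rw [adjacency, Matrix.of_apply, adjCoeff]
  split_ifs <;> simp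

theorem comm_adjacency_iff {A : Type*} [CStarAlgebra A] (q : Matrix V V A) :
    q * 𝒢.adjacency A = 𝒢.adjacency A * q ↔
      ∀ v w, ∑ x, 𝒢.adjCoeff x w • q v x = ∑ x, 𝒢.adjCoeff v x • q x w := by
  rw [← Matrix.ext_iff]
  simp only [mul_adjacency_apply, adjacency_mul_apply]

theorem banicaRelations_one (A : Type*) [CStarAlgebra A] :
    𝒢.BanicaRelations (1 : Matrix V V A) where
  star_eq v w := by rw [Matrix.one_apply]; split_ifs <;> simp
  sq_eq v w := by rw [Matrix.one_apply]; split_ifs <;> simp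
  sum_row v := by simp [Matrix.one_apply]
  sum_col v := by simp [Matrix.one_apply]
  comm_adjacency := by rw [one_mul, mul_one]

namespace BanicaRelations

variable {A : Type u} [CStarAlgebra A] {q : Matrix V V A} (h : 𝒢.BanicaRelations q)

include h

theorem row_mul (v w w' : V) : q v w * q v w' = if w = w' then q v w else 0 := by
  split_ifs with hw
  · rw [← hw, h.sq_eq]
  · exact mul_eq_zero_of_sum_eq_one (fun w => q v w) (h.star_eq v) (h.sq_eq v) (h.sum_row v) hw

theorem col_mul (w v v' : V) : q v w * q v' w = if v = v' then q v w else 0 := by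
  split_ifs with hv
  · rw [← hv, h.sq_eq]
  · exact mul_eq_zero_of_sum_eq_one (fun v => q v w) (fun v => h.star_eq v w)
      (fun v => h.sq_eq v w) (h.sum_col w) hv

/-- Multiply the `(v, w)` entry of `q D = D q` by `q v y` on the left and `q z w` on the right:
orthogonality leaves the single term `q v y * q z w`, with coefficient `D y w` on one side and `D v
z` on the other. -/
theorem mul_eq_zero {v y z w : V} (hne : 𝒢.adjCoeff v z ≠ 𝒢.adjCoeff y w) :
    q v y * q z w = 0 := by
  have h1 := congrArg (fun a => q v y * a * q z w) ((comm_adjacency_iff q).1 h.comm_adjacency v w)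
  simp only [Finset.mul_sum, Finset.sum_mul, mul_smul_comm, smul_mul_assoc, h.row_mul] at h1
  simp only [mul_assoc, h.col_mul] at h1
  simp only [ite_mul, zero_mul, mul_ite, mul_zero, smul_ite, smul_zero, Finset.sum_ite_eq,
    Finset.sum_ite_eq', Finset.mem_univ, if_true] at h1
  rw [← sub_eq_zero, ← sub_smul, smul_eq_zero, sub_eq_zero] at h1
  exact h1.resolve_left hne.symm

theorem comul : 𝒢.BanicaRelations
    (Matrix.of fun v w => ∑ x, (tmul (q v x) (q x w) : MinTensor A A)) where
  star_eq v w := by simp only [Matrix.of_apply, star_sum, star_tmul, h.star_eq]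
  sq_eq v w := by
    simp only [Matrix.of_apply, Finset.sum_mul_sum, tmul_mul_tmul, h.row_mul]
    refine Finset.sum_congr rfl fun x _ => ?_
    rw [Finset.sum_eq_single x]
    · rw [if_pos rfl, h.sq_eq]
    · intro y _ hy; rw [if_neg hy.symm, zero_tmul]
    · simp
  sum_row v := by
    simp only [Matrix.of_apply]
    rw [Finset.sum_comm]
    simp only [← tmul_sum, h.sum_row, ← sum_tmul, one_tmul_one]
  sum_col w := by
    simp only [Matrix.of_apply]
    rw [Finset.sum_comm]
    simp only [← tmul_sum, h.sum_col, ← sum_tmul, one_tmul_one]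
  comm_adjacency := by
    have hc := (comm_adjacency_iff q).1 h.comm_adjacency
    refine (comm_adjacency_iff _).2 fun v w => ?_
    simp only [Matrix.of_apply, Finset.smul_sum, ← tmul_smul]
    rw [Finset.sum_comm]
    simp only [← tmul_sum, hc]
    simp only [tmul_sum, tmul_smul, ← smul_tmul]
    rw [Finset.sum_comm]
    simp only [← sum_tmul, hc]
    simp only [sum_tmul]
    exact Finset.sum_comm

end BanicaRelations

variable (𝒢)

open FreeStarAlgebra in
theorem exists_universal_banica : ∃ (A : Type u) (_ : CStarAlgebra A) (q : Matrix V V A),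
    𝒢.BanicaRelations q ∧
    Dense (Algebra.adjoin ℂ (Set.range fun p : V × V => q p.1 p.2) : Set A) ∧
    ∀ (B : Type u) [CStarAlgebra B] (b : Matrix V V B), 𝒢.BanicaRelations b →
      ∃ f : A →⋆ₐ[ℂ] B, ∀ v w, f (q v w) = b v w := by
  -- The generators are indexed by a copy of `V × V` in the universe of the C⋆-algebras.
  let X : Type u := ULift.{u} (Fin (Fintype.card (V × V)))
  let i : V × V ≃ X := (Fintype.equivFin _).trans Equiv.ulift.symm
  let R : ∀ (B : Type u) [CStarAlgebra B], (X → B) → Prop := fun B _ b =>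
    𝒢.BanicaRelations (Matrix.of fun v w => b (i (v, w)))
  have key : ∀ {B : Type u} [CStarAlgebra B] {b : X → B}, R B b → ∀ x,
      star (b x) = b x ∧ b x * b x = b x := fun {B _ b} hb x => by
    have h1 := hb.star_eq (i.symm x).1 (i.symm x).2
    have h2 := hb.sq_eq (i.symm x).1 (i.symm x).2
    simp only [Matrix.of_apply, Prod.mk.eta, Equiv.apply_symm_apply] at h1 h2
    exact ⟨h1, h2⟩
  obtain ⟨A, _, a, hstar, hdense, hrel, hlift⟩ := exists_universal_cstarAlgebra R
    (fun B _ b hb x => (key hb x).1)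
    (fun B _ b hb x => norm_le_one_of_mul_self (key hb x).1 (key hb x).2)
  refine ⟨A, _, Matrix.of fun v w => a (i (v, w)), ⟨fun v w => hstar _, fun v w => ?_, fun v => ?_,
    fun w => ?_, ?_⟩, ?_, fun B _ b hb => ?_⟩
  · have := hrel (gen (i (v, w)) * gen (i (v, w)) - gen (i (v, w))) fun B _ b hb => by
      rw [map_sub, map_mul, lift_gen, (key hb _).2, sub_self]
    rwa [map_sub, map_mul, lift_gen, sub_eq_zero] at this
  · have := hrel (∑ w, gen (i (v, w)) - 1) fun B _ b hb => by
      rw [map_sub, map_sum, map_one, sub_eq_zero]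
      simp only [lift_gen]
      exact hb.sum_row v
    rw [map_sub, map_sum, map_one, sub_eq_zero] at this
    simp only [lift_gen] at this
    exact this
  · have := hrel (∑ v, gen (i (v, w)) - 1) fun B _ b hb => by
      rw [map_sub, map_sum, map_one, sub_eq_zero]
      simp only [lift_gen]
      exact hb.sum_col w
    rw [map_sub, map_sum, map_one, sub_eq_zero] at this
    simp only [lift_gen] at this
    exact this
  · refine (comm_adjacency_iff _).2 fun v w => ?_
    have := hrel (∑ x, 𝒢.adjCoeff x w • gen (i (v, x)) - ∑ x, 𝒢.adjCoeff v x • gen (i (x, w)))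
      fun B _ b hb => by
        rw [map_sub, map_sum, map_sum, sub_eq_zero]
        simp only [map_smul, lift_gen]
        exact (comm_adjacency_iff _).1 hb.comm_adjacency v w
    rw [map_sub, map_sum, map_sum, sub_eq_zero] at this
    simp only [map_smul, lift_gen] at this
    exact this
  · have : (Set.range fun p : V × V => a (i (p.1, p.2))) = Set.range a :=
      i.surjective.range_comp a
    simpa only [Matrix.of_apply, this] using hdense
  · obtain ⟨f, hf⟩ := hlift B (fun x => b (i.symm x).1 (i.symm x).2) (by
      simp only [R, Equiv.symm_apply_apply]
      exact hb)
    exact ⟨f, fun v w => by simpa using hf (i (v, w))⟩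

/-- The quantum automorphism group `Aut⁺_Ban(𝒢)`, with its generating matrix. -/
theorem exists_compactQuantumGroup : ∃ (H : CompactQuantumGroup.{u}) (q : Matrix V V H.alg),
    𝒢.BanicaRelations q ∧
    Dense (Algebra.adjoin ℂ (Set.range fun p : V × V => q p.1 p.2) : Set H.alg) ∧
    (∀ (B : Type u) [CStarAlgebra B] (b : Matrix V V B), 𝒢.BanicaRelations b →
      ∃ f : H.alg →⋆ₐ[ℂ] B, ∀ v w, f (q v w) = b v w) ∧
    ∀ v w, H.comul (q v w) = ∑ x, tmul (q v x) (q x w) := by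
  obtain ⟨A, _, q, hq, hdense, hlift⟩ := 𝒢.exists_universal_banica
  -- The identity matrix satisfies the relations over `ℂ`, written as functions on a point to land
  -- in the right universe. The resulting character, the counit, shows that the universal algebra is
  -- nonzero.
  obtain ⟨ε, -⟩ := hlift (PUnit.{u + 1} → ℂ) 1 (banicaRelations_one _)
  have : Nontrivial A := ⟨0, 1, fun h01 => by
    have := congrArg ε h01
    rw [map_zero, map_one] at this
    exact zero_ne_one this⟩
  obtain ⟨Δ, hΔ'⟩ := hlift (MinTensor A A) _ hq.comul
  have hΔ : ∀ v w, Δ (q v w) = ∑ x, tmul (q v x) (q x w) := hΔ'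
  have hcomm : ∀ a b : A, (inclLeft a * inclRight b : MinTensor A A) = inclRight b * inclLeft a :=
    fun a b => by
      rw [inclLeft_apply, inclRight_apply, tmul_mul_tmul, tmul_mul_tmul, one_mul, mul_one, one_mul,
        mul_one]
  refine ⟨⟨A, Δ, fun a => ?_, ?_, ?_⟩, q, hq, hdense, hlift, hΔ⟩
  · rw [← mem_assocSubalgebra]
    let F : A →ₐ[ℂ] MinTensor (MinTensor A A) A × MinTensor A (MinTensor A A) :=
      AlgHom.prod ((CStarTensor.map Δ (.id ℂ A)).comp Δ).toAlgHom
        ((CStarTensor.map (.id ℂ A) Δ).comp Δ).toAlgHom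
    have hF : Continuous F := by
      open scoped CStarAlgebra in
      exact (map_continuous ((CStarTensor.map Δ (.id ℂ A)).comp Δ)).prodMk
        (map_continuous ((CStarTensor.map (.id ℂ A) Δ).comp Δ))
    refine Subalgebra.mem_of_dense_adjoin hdense ((assocSubalgebra A A A).comap F)
      ((Subalgebra.isClosed_topologicalClosure _).preimage hF) ?_ a
    rintro _ ⟨⟨v, w⟩, rfl⟩
    change (CStarTensor.map Δ (.id ℂ A) (Δ (q v w)), CStarTensor.map (.id ℂ A) Δ (Δ (q v w))) ∈
      assocSubalgebra A A A
    have : (CStarTensor.map Δ (.id ℂ A) (Δ (q v w)), CStarTensor.map (.id ℂ A) Δ (Δ (q v w))) =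
        ∑ x, ∑ y, (tmul (tmul (q v y) (q y x)) (q x w), tmul (q v y) (tmul (q y x) (q x w))) := by
      refine Prod.ext ?_ ?_
      · simp only [hΔ, map_sum, map_tmul, StarAlgHom.coe_id, id_eq, sum_tmul, Prod.fst_sum]
      · simp only [hΔ, map_sum, map_tmul, StarAlgHom.coe_id, id_eq, tmul_sum, Prod.snd_sum]
        exact Finset.sum_comm
    rw [this]
    exact sum_mem fun x _ => sum_mem fun y _ =>
      Subalgebra.le_topologicalClosure _ (Algebra.subset_adjoin ⟨_, _, _, rfl⟩)
  · have hS := mul_mem_closure_span_of_generators hdense Δ inclLeft inclRight hcomm (by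
      rintro _ ⟨⟨v, x⟩, rfl⟩
      -- The coinverse would send `q w x` to `q x w`. Expanding `Δ`, column orthogonality keeps only
      -- the middle index `x`, and the row sum then gives `1`.
      have : inclLeft (q v x) = ∑ w, Δ (q v w) * inclRight (q x w) := by
        simp only [hΔ, inclLeft_apply, inclRight_apply, Finset.sum_mul, tmul_mul_tmul, mul_one,
          hq.col_mul]
        rw [Finset.sum_comm]
        simp only [← tmul_sum]
        rw [Finset.sum_eq_single x]
        · simp [hq.sum_row]
        · intro y _ hy; simp [hy, tmul_zero]
        · simp
      change inclLeft (q v x) ∈ _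
      rw [this]
      exact sum_mem fun w _ => Submodule.le_topologicalClosure _
        (Submodule.subset_span ⟨_, _, rfl⟩))
    intro x
    refine mem_of_tmul_mem _ (Submodule.isClosed_topologicalClosure _) (fun a b => ?_) x
    have := hS a b
    rwa [inclLeft_apply, inclRight_apply, tmul_mul_tmul, mul_one, one_mul] at this
  · have hS := mul_mem_closure_span_of_generators hdense Δ inclRight inclLeft
      (fun a b => (hcomm b a).symm) (by
      rintro _ ⟨⟨x, w⟩, rfl⟩
      -- The mirror image: row orthogonality selects the middle index `x`, and the column sum gives
      -- `1`.
      have : inclRight (q x w) = ∑ v, Δ (q v w) * inclLeft (q v x) := by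
        simp only [hΔ, inclLeft_apply, inclRight_apply, Finset.sum_mul, tmul_mul_tmul, mul_one,
          hq.row_mul]
        rw [Finset.sum_comm]
        simp only [← sum_tmul]
        rw [Finset.sum_eq_single x]
        · simp [hq.sum_col]
        · intro y _ hy; simp [hy, zero_tmul]
        · simp
      change inclRight (q x w) ∈ _
      rw [this]
      exact sum_mem fun w _ => Submodule.le_topologicalClosure _
        (Submodule.subset_span ⟨_, _, rfl⟩))
    intro x
    refine mem_of_tmul_mem _ (Submodule.isClosed_topologicalClosure _) (fun a b => ?_) x
    have := hS b a
    rwa [inclLeft_apply, inclRight_apply, tmul_mul_tmul, mul_one, one_mul] at this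

end BanicaRelations

end DirectedGraph

/-! ### The actions on vertices and edges defined by a Banica matrix -/

namespace DirectedGraph

section EdgeSums

variable {V : Type v} {E : Type w} [Fintype V] [DecidableEq V] [Fintype E]
  {𝒢 : DirectedGraph V E}

/-- Without multiple edges, an edge is the pair of its endpoints. This turns edge sums into double
vertex sums, provided that the summand vanishes on non-adjacent pairs. -/
theorem IsSimple.sum_edges (h𝒢 : 𝒢.IsSimple) {M : Type*} [AddCommMonoid M] (G : V → V → M)
    (hG : ∀ x y, 𝒢.adjCoeff x y ≠ 1 → G x y = 0) :
    ∑ e, G (𝒢.s e) (𝒢.r e) = ∑ x, ∑ y, G x y := by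
  rw [← Fintype.sum_prod_type']
  refine Fintype.sum_of_injective (fun e => (𝒢.s e, 𝒢.r e)) (fun e f h => ?_) _ _
    (fun p hp => hG _ _ fun h => hp ?_) fun e => rfl
  · obtain ⟨h1, h2⟩ := Prod.mk.inj h
    exact h𝒢.no_multiple_edges e f h1 h2
  · by_contra hne
    rw [adjCoeff, if_neg] at h
    · exact zero_ne_one h
    · rintro ⟨e, h1, h2⟩
      exact hne ⟨e, Prod.ext h1 h2⟩

end EdgeSums

namespace BanicaRelations

variable {V : Type v} {E : Type w} [Fintype V] [DecidableEq V] [Fintype E]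
  {𝒢 : DirectedGraph V E} {A : Type u} [CStarAlgebra A] {q : Matrix V V A}
  (h : 𝒢.BanicaRelations q)

/-- The action `δ_w ↦ ∑ v, δ_v ⊗ q v w` on the functions on the vertices. -/
noncomputable def vertexAction : (V → ℂ) →⋆ₐ[ℂ] (V → A) where
  toFun f v := ∑ w, f w • q v w
  map_one' := funext fun v => by simpa using h.sum_row v
  map_mul' f g := funext fun v => by
    simp only [Pi.mul_apply, Finset.sum_mul_sum, smul_mul_smul_comm, h.row_mul, smul_ite, smul_zero,
      Finset.sum_ite_eq, Finset.mem_univ, if_true]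
  map_zero' := funext fun v => by simp
  map_add' f g := funext fun v => by simp [add_smul, Finset.sum_add_distrib]
  commutes' c := funext fun v => by
    simp [← Finset.smul_sum, h.sum_row, Algebra.algebraMap_eq_smul_one]
  map_star' f := funext fun v => by simp [star_sum, h.star_eq]

theorem vertexAction_apply (f : V → ℂ) (v : V) : h.vertexAction f v = ∑ w, f w • q v w := rfl

theorem vertexAction_single (v w : V) : h.vertexAction (Pi.single w 1) v = q v w := by
  simp [vertexAction_apply, Pi.single_apply]

theorem mul_vertexAction (f : V → ℂ) (v w : V) : q v w * h.vertexAction f v = f w • q v w := by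
  simp [vertexAction_apply, Finset.mul_sum, h.row_mul]

theorem vertexAction_mul (f : V → ℂ) (v w : V) : h.vertexAction f v * q v w = f w • q v w := by
  simp [vertexAction_apply, Finset.sum_mul, h.row_mul]

variable (𝒢 q) in
/-- The action `δ_f ↦ ∑ e, δ_e ⊗ q (s e) (s f) q (r e) (r f)` on the functions on the edges. -/
noncomputable def edgeAction : (E → ℂ) →ₗ[ℂ] (E → A) where
  toFun ξ e := ∑ f, ξ f • (q (𝒢.s e) (𝒢.s f) * q (𝒢.r e) (𝒢.r f))
  map_add' ξ η := funext fun e => by simp [add_smul, Finset.sum_add_distrib]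
  map_smul' c ξ := funext fun e => by simp [mul_smul, Finset.smul_sum]

omit [Fintype V] [DecidableEq V] in
theorem edgeAction_apply (ξ : E → ℂ) (e : E) : edgeAction 𝒢 q ξ e =
    ∑ f, ξ f • (q (𝒢.s e) (𝒢.s f) * q (𝒢.r e) (𝒢.r f)) := rfl

omit [Fintype V] [DecidableEq V] in
theorem edgeAction_single [DecidableEq E] (e f : E) : edgeAction 𝒢 q (Pi.single f 1) e =
    q (𝒢.s e) (𝒢.s f) * q (𝒢.r e) (𝒢.r f) := by
  simp [edgeAction_apply, Pi.single_apply]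

include h

theorem mul_eq_zero_of_edge (e : E) {x y : V} (hxy : 𝒢.adjCoeff x y ≠ 1) :
    q (𝒢.s e) x * q (𝒢.r e) y = 0 :=
  h.mul_eq_zero (by rw [adjCoeff_edge]; exact hxy.symm)

theorem mul_eq_zero_of_edge' (f : E) {x y : V} (hxy : 𝒢.adjCoeff x y ≠ 1) :
    q x (𝒢.s f) * q y (𝒢.r f) = 0 :=
  h.mul_eq_zero (by rw [adjCoeff_edge]; exact hxy)

theorem edgeAction_rightMul (ξ : E → ℂ) (f : V → ℂ) :
    edgeAction 𝒢 q (𝒢.rightMul ξ f) = 𝒢.rightMul (edgeAction 𝒢 q ξ) (h.vertexAction f) := by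
  funext e
  simp only [edgeAction_apply, rightMul, Finset.sum_mul, smul_mul_assoc, mul_assoc,
    h.mul_vertexAction, mul_smul_comm, smul_smul]

theorem edgeAction_leftMul (f : V → ℂ) (ξ : E → ℂ) :
    edgeAction 𝒢 q (𝒢.leftMul f ξ) = 𝒢.leftMul (h.vertexAction f) (edgeAction 𝒢 q ξ) := by
  funext e
  simp only [edgeAction_apply, leftMul, Finset.mul_sum, mul_smul_comm, ← mul_assoc,
    h.vertexAction_mul, smul_mul_assoc, smul_smul, mul_comm]

/-- Since `q (s e) x * q (r e) y = 0` off the edges, the edge sum runs over all pairs `(x, y)`, and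
summing over `x` uses up the first factor. -/
theorem vertexAction_range (h𝒢 : 𝒢.IsSimple) (f : V → ℂ) (e : E) :
    h.vertexAction f (𝒢.r e) = edgeAction 𝒢 q (f ∘ 𝒢.r) e := by
  simp only [edgeAction_apply, Function.comp_apply]
  rw [h𝒢.sum_edges (fun x y => f y • (q (𝒢.s e) x * q (𝒢.r e) y))
    (fun x y hxy => by rw [h.mul_eq_zero_of_edge e hxy, smul_zero]), Finset.sum_comm]
  simp only [← Finset.smul_sum, ← Finset.sum_mul, h.sum_row, one_mul, vertexAction_apply]

/-- The isometry of `λ` on basis vectors. Distinct sources are orthogonal; for equal sources the sum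
extends to all pairs, the column sum of `q` removes the source factor, and row orthogonality
compares the ranges. -/
theorem sum_edges_into (h𝒢 : 𝒢.IsSimple) [DecidableEq E] (v : V) (f g : E) :
    ∑ e with 𝒢.r e = v, q (𝒢.r e) (𝒢.r f) * q (𝒢.s e) (𝒢.s f) *
      (q (𝒢.s e) (𝒢.s g) * q (𝒢.r e) (𝒢.r g)) = if f = g then q v (𝒢.r f) else 0 := by
  by_cases hs : 𝒢.s f = 𝒢.s g
  · have h1 : ∀ e, q (𝒢.r e) (𝒢.r f) * q (𝒢.s e) (𝒢.s f) *
        (q (𝒢.s e) (𝒢.s g) * q (𝒢.r e) (𝒢.r g)) =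
        q (𝒢.r e) (𝒢.r f) * (q (𝒢.s e) (𝒢.s g) * q (𝒢.r e) (𝒢.r g)) := fun e => by
      rw [hs, mul_assoc, ← mul_assoc (q (𝒢.s e) (𝒢.s g)), h.sq_eq]
    simp only [h1]
    rw [Finset.sum_filter, h𝒢.sum_edges
      (fun x y => if y = v then q y (𝒢.r f) * (q x (𝒢.s g) * q y (𝒢.r g)) else 0)
      (fun x y hxy => by rw [h.mul_eq_zero_of_edge' g hxy, mul_zero, ite_self])]
    simp only [Finset.sum_ite_eq', Finset.mem_univ, if_true, ← Finset.mul_sum, ← Finset.sum_mul,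
      h.sum_col, one_mul, h.row_mul]
    by_cases hr : 𝒢.r f = 𝒢.r g
    · rw [if_pos hr, if_pos (h𝒢.no_multiple_edges f g hs hr)]
    · rw [if_neg hr, if_neg fun hfg => hr (congrArg _ hfg)]
  · rw [if_neg fun hfg => hs (congrArg _ hfg)]
    refine Finset.sum_eq_zero fun e _ => ?_
    rw [mul_assoc, ← mul_assoc (q (𝒢.s e) (𝒢.s f)), h.row_mul, if_neg hs, zero_mul, mul_zero]

theorem edgeAction_edgeInner (h𝒢 : 𝒢.IsSimple) (ξ η : E → ℂ) :
    𝒢.edgeInner (edgeAction 𝒢 q ξ) (edgeAction 𝒢 q η) =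
      h.vertexAction (𝒢.edgeInner ξ η) := by
  classical
  funext v
  have h1 : ∀ e, star (edgeAction 𝒢 q ξ e) * edgeAction 𝒢 q η e =
      ∑ f, ∑ g, (star (ξ f) * η g) • (q (𝒢.r e) (𝒢.r f) * q (𝒢.s e) (𝒢.s f) *
        (q (𝒢.s e) (𝒢.s g) * q (𝒢.r e) (𝒢.r g))) := fun e => by
    simp only [edgeAction_apply, star_sum, star_smul, star_mul, h.star_eq, Finset.sum_mul_sum,
      smul_mul_smul_comm]
  simp only [edgeInner, h1]
  rw [Finset.sum_comm]
  simp only [Finset.sum_comm (s := Finset.univ.filter fun e => 𝒢.r e = v), ← Finset.smul_sum,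
    h.sum_edges_into h𝒢, smul_ite, smul_zero, Finset.sum_ite_eq, Finset.mem_univ, if_true,
    vertexAction_apply, edgeInner, Finset.sum_smul, Finset.sum_filter, ite_smul, zero_smul]
  rw [Finset.sum_comm]
  simp

/-- The transpose inverts a magic unitary: `∑ w, q v w * q x w = δ_{vx}`. The span in the Podleś
condition is therefore the whole space. -/
theorem single_mem_span_vertexAction (x : V) (a : A) : (Pi.single x a : V → A) ∈
    Submodule.span ℂ {F | ∃ ξ a, F = fun x => h.vertexAction ξ x * a} := by
  have : (Pi.single x a : V → A) =
      ∑ w, fun v => h.vertexAction (Pi.single w 1) v * (q x w * a) := by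
    funext v
    simp only [Finset.sum_apply, vertexAction_single, ← mul_assoc, h.col_mul, ite_mul, zero_mul]
    by_cases hv : v = x
    · subst hv; simp [← Finset.sum_mul, h.sum_row]
    · simp [hv]
  rw [this]
  exact Submodule.sum_mem _ fun w _ => Submodule.subset_span ⟨_, _, rfl⟩

/-- The edge matrix times its adjoint is the identity, by the same extension of edge sums to all
pairs of vertices. -/
theorem single_mem_span_edgeAction (h𝒢 : 𝒢.IsSimple) [DecidableEq E] (e : E) (a : A) :
    (Pi.single e a : E → A) ∈
      Submodule.span ℂ {F | ∃ ξ a, F = fun x => edgeAction 𝒢 q ξ x * a} := by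
  have : (Pi.single e a : E → A) = ∑ f, fun e' => edgeAction 𝒢 q (Pi.single f 1) e' *
      (q (𝒢.r e) (𝒢.r f) * q (𝒢.s e) (𝒢.s f) * a) := by
    funext e'
    simp only [Finset.sum_apply, edgeAction_single]
    by_cases hr : 𝒢.r e' = 𝒢.r e
    · have h1 : ∀ f, q (𝒢.s e') (𝒢.s f) * q (𝒢.r e') (𝒢.r f) *
          (q (𝒢.r e) (𝒢.r f) * q (𝒢.s e) (𝒢.s f) * a) =
          q (𝒢.s e') (𝒢.s f) * q (𝒢.r e') (𝒢.r f) * q (𝒢.s e) (𝒢.s f) * a := fun f => by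
        rw [← mul_assoc, ← mul_assoc, mul_assoc (q (𝒢.s e') (𝒢.s f)), hr, h.sq_eq]
      simp only [h1]
      rw [h𝒢.sum_edges (fun x y => q (𝒢.s e') x * q (𝒢.r e') y * q (𝒢.s e) x * a)
        (fun x y hxy => by rw [h.mul_eq_zero_of_edge e' hxy, zero_mul, zero_mul])]
      simp only [← Finset.sum_mul, ← Finset.mul_sum, h.sum_row, mul_one, h.col_mul]
      by_cases hs : 𝒢.s e' = 𝒢.s e
      · rw [h𝒢.no_multiple_edges e' e hs hr]
        simp [h.sum_row]
      · simp only [if_neg hs, Finset.sum_const_zero, zero_mul]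
        rw [Pi.single_eq_of_ne fun hee => hs (congrArg _ hee)]
    · rw [Pi.single_eq_of_ne fun hee => hr (congrArg _ hee)]
      refine (Finset.sum_eq_zero fun f _ => ?_).symm
      rw [← mul_assoc, ← mul_assoc, mul_assoc (q (𝒢.s e') (𝒢.s f)), h.col_mul, if_neg hr,
        mul_zero, zero_mul, zero_mul]
  rw [this]
  exact Submodule.sum_mem _ fun w _ => Submodule.subset_span ⟨_, _, rfl⟩

end BanicaRelations

/-! ### The object attached to a Banica matrix -/

section UniversalObject

theorem dense_of_single_mem {X : Type*} [Fintype X] [DecidableEq X] {A : Type*} [CStarAlgebra A]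
    (T : Submodule ℂ (X → A)) (h : ∀ x a, Pi.single x a ∈ T) : Dense (T : Set (X → A)) := by
  have : T = ⊤ := Submodule.eq_top_iff'.2 fun F => by
    rw [← Finset.univ_sum_single F]
    exact T.sum_mem fun x _ => h x (F x)
  rw [this]
  exact dense_univ

variable {V : Type v} {E : Type w} [Fintype V] [DecidableEq V] [Fintype E] [DecidableEq E]
  {𝒢 : DirectedGraph V E} {H : CompactQuantumGroup.{u}} {q : Matrix V V H.alg}

omit [DecidableEq E] in
theorem isGAlgebra_vertexAction (h : 𝒢.BanicaRelations q)
    (hΔ : ∀ v w, H.comul (q v w) = ∑ x, tmul (q v x) (q x w)) :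
    H.IsGAlgebra h.vertexAction where
  coassoc ξ x := by
    change ∑ y, tmul (h.vertexAction (Pi.single y 1) x) (h.vertexAction ξ y) =
      H.comul (h.vertexAction ξ x)
    simp only [h.vertexAction_single, h.vertexAction_apply, map_sum, map_smul, hΔ, tmul_sum,
      tmul_smul, Finset.smul_sum]
    exact Finset.sum_comm
  podles := dense_of_single_mem _ h.single_mem_span_vertexAction

/-- Comultiplying a product of two entries of `q` produces a sum over all pairs of vertices, of
which only the edges survive. -/
theorem isCoaction_edgeAction (h𝒢 : 𝒢.IsSimple) (h : 𝒢.BanicaRelations q)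
    (hΔ : ∀ v w, H.comul (q v w) = ∑ x, tmul (q v x) (q x w)) :
    H.IsCoaction (BanicaRelations.edgeAction 𝒢 q) where
  coassoc ξ e := by
    simp only [BanicaRelations.edgeAction_single]
    simp only [BanicaRelations.edgeAction_apply, map_sum,
      map_smul, map_mul, hΔ, tmul_sum, tmul_smul]
    rw [Finset.sum_comm]
    refine Finset.sum_congr rfl fun f _ => ?_
    rw [← Finset.smul_sum, Finset.sum_mul_sum, h𝒢.sum_edges (fun x y =>
      tmul (q (𝒢.s e) x * q (𝒢.r e) y) (q x (𝒢.s f) * q y (𝒢.r f)))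
      (fun x y hxy => by rw [h.mul_eq_zero_of_edge e hxy, zero_tmul])]
    simp only [tmul_mul_tmul]
  podles := dense_of_single_mem _ (h.single_mem_span_edgeAction h𝒢)

-- The entries of `q` are slices of `α`, and since there is a vertex, `1` is a row sum of them; so
-- the non-unital ⋆-algebra of slices contains the unital algebra generated by `q`.
omit [DecidableEq E] in
theorem isFaithful_vertexAction [Nonempty V] (h : 𝒢.BanicaRelations q)
    (hd : Dense (Algebra.adjoin ℂ (Set.range fun p : V × V => q p.1 p.2) : Set H.alg)) :
    H.IsFaithful h.vertexAction := by
  set N := NonUnitalStarAlgebra.adjoin ℂ {c | ∃ (ω : (V → ℂ) →L[ℂ] ℂ) (f : V → ℂ),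
    c = ∑ x, ω (Pi.single x 1) • h.vertexAction f x} with hN
  have hq : ∀ v w, q v w ∈ N := fun v w => NonUnitalStarAlgebra.subset_adjoin ℂ _
    ⟨ContinuousLinearMap.proj v, Pi.single w 1, by
      simp [h.vertexAction_single, Pi.single_apply]⟩
  have h1 : (1 : H.alg) ∈ N := by
    obtain ⟨v⟩ := ‹Nonempty V›
    rw [← h.sum_row v]
    exact sum_mem fun w _ => hq v w
  let K : Subalgebra ℂ H.alg :=
    { carrier := N
      mul_mem' := fun hx hy => mul_mem hx hy
      add_mem' := fun hx hy => add_mem hx hy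
      algebraMap_mem' := fun c => by
        rw [Algebra.algebraMap_eq_smul_one]
        exact SMulMemClass.smul_mem c h1 }
  have hle : Algebra.adjoin ℂ (Set.range fun p : V × V => q p.1 p.2) ≤ K :=
    Algebra.adjoin_le (by rintro _ ⟨p, rfl⟩; exact hq p.1 p.2)
  exact hd.mono hle

/-- The object of `C_Ban(𝒢)` given by a compact quantum group with a matrix satisfying the relations
of `Aut⁺_Ban(𝒢)`. -/
noncomputable def BanObj.ofRelations [Nonempty V] (h𝒢 : 𝒢.IsSimple) (h : 𝒢.BanicaRelations q)
    (hd : Dense (Algebra.adjoin ℂ (Set.range fun p : V × V => q p.1 p.2) : Set H.alg))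
    (hΔ : ∀ v w, H.comul (q v w) = ∑ x, tmul (q v x) (q x w)) : BanObj.{u} 𝒢 where
  G := H
  act := h.vertexAction
  edgeAct := BanicaRelations.edgeAction 𝒢 q
  isGAlgebra := isGAlgebra_vertexAction h hΔ
  faithful := isFaithful_vertexAction h hd
  equivariant :=
    { map_rightMul := h.edgeAction_rightMul
      map_edgeInner := h.edgeAction_edgeInner h𝒢
      coaction := isCoaction_edgeAction h𝒢 h hΔ
      map_leftMul := h.edgeAction_leftMul }
  range_compat := h.vertexAction_range h𝒢

end UniversalObject

end DirectedGraph

/-! ### From an object of the category to the Banica relations -/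

namespace DirectedGraph

section Relations

variable {V : Type v} {E : Type w} [Fintype V] [DecidableEq V] [Fintype E]
  {𝒢 : DirectedGraph V E} {A : Type u} [CStarAlgebra A]

/-- For a magic unitary `q`, half of the relation `q D = D q` implies all of it. -/
theorem banicaRelations_of_mul_eq_zero (q : Matrix V V A) (hstar : ∀ v w, star (q v w) = q v w)
    (hsq : ∀ v w, q v w * q v w = q v w) (hrow : ∀ v, ∑ w, q v w = 1)
    (hcol : ∀ w, ∑ v, q v w = 1)
    (hmul : ∀ v z y w, 𝒢.adjCoeff v z = 1 → 𝒢.adjCoeff y w ≠ 1 → q v y * q z w = 0) :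
    𝒢.BanicaRelations q := by
  refine ⟨hstar, hsq, hrow, hcol, (comm_adjacency_iff q).2 ?_⟩
  have hrm : ∀ v w w', q v w * q v w' = if w = w' then q v w else 0 := fun v w w' => by
    split_ifs with hw
    · rw [← hw, hsq]
    · exact mul_eq_zero_of_sum_eq_one (fun w => q v w) (hstar v) (hsq v) (hrow v) hw
  have hcm : ∀ w v v', q v w * q v' w = if v = v' then q v w else 0 := fun w v v' => by
    split_ifs with hv
    · rw [← hv, hsq]
    · exact mul_eq_zero_of_sum_eq_one (fun v => q v w) (fun v => hstar v w) (fun v => hsq v w)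
        (hcol w) hv
  have hd : ∀ v w, 𝒢.adjCoeff v w = 1 ∨ 𝒢.adjCoeff v w = 0 := fun v w => by
    rw [adjCoeff]; split_ifs <;> simp
  have hdd : ∀ v w, 𝒢.adjCoeff v w * 𝒢.adjCoeff v w = 𝒢.adjCoeff v w := fun v w => by
    rcases hd v w with h | h <;> simp [h]
  have hds : ∀ v w, star (𝒢.adjCoeff v w) = 𝒢.adjCoeff v w := fun v w => by
    rcases hd v w with h | h <;> simp [h]
  let L : V → V → A := fun v w => ∑ x, 𝒢.adjCoeff x w • q v x
  let R : V → V → A := fun v w => ∑ x, 𝒢.adjCoeff v x • q x w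
  have hLs : ∀ v w, star (L v w) = L v w := fun v w => by
    simp only [L, star_sum, star_smul, hds, hstar]
  have hRs : ∀ v w, star (R v w) = R v w := fun v w => by
    simp only [R, star_sum, star_smul, hds, hstar]
  have hLL : ∀ v w, L v w * L v w = L v w := fun v w => by
    simp [L, Finset.sum_mul_sum, hrm, smul_smul, hdd]
  have hRR : ∀ v w, R v w * R v w = R v w := fun v w => by
    simp [R, Finset.sum_mul_sum, hcm, smul_smul, hdd]
  -- `R v w ≤ L v w` as projections: the hypothesis kills `q v y * R v w` unless `y` is adjacent to
  -- `w`, so inserting the full row sum or only the part in `L v w` makes no difference.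
  have hLR : ∀ v w, L v w * R v w = R v w := fun v w => by
    have h1 : ∀ y, q v y * R v w = 𝒢.adjCoeff y w • (q v y * R v w) := fun y => by
      rcases hd y w with h | h
      · rw [h, one_smul]
      · rw [h, zero_smul]
        simp only [R, Finset.mul_sum, mul_smul_comm]
        refine Finset.sum_eq_zero fun z _ => ?_
        rcases hd v z with h' | h'
        · rw [hmul v z y w h' (by rw [h]; exact zero_ne_one), smul_zero]
        · rw [h', zero_smul]
    calc L v w * R v w = ∑ y, 𝒢.adjCoeff y w • (q v y * R v w) := by
          simp only [L, Finset.sum_mul, smul_mul_assoc]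
      _ = ∑ y, q v y * R v w := Finset.sum_congr rfl fun y _ => (h1 y).symm
      _ = R v w := by rw [← Finset.sum_mul, hrow, one_mul]
  have hRL : ∀ v w, R v w * L v w = R v w := fun v w => by
    have := congrArg star (hLR v w)
    rwa [star_mul, hLs, hRs] at this
  -- The `L - R` are projections. Column sums reduce the total of `L`, and row sums that of `R`, to
  -- the same multiple of `1`, the sum of the adjacency coefficients.
  have hsum : ∑ p : V × V, star (L p.1 p.2 - R p.1 p.2) * (L p.1 p.2 - R p.1 p.2) = 0 := by
    have h1 : ∀ v w, star (L v w - R v w) * (L v w - R v w) = L v w - R v w := fun v w => by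
      rw [star_sub, hLs, hRs, sub_mul, mul_sub, mul_sub, hLL, hLR, hRL, hRR]
      abel
    simp only [h1, Fintype.sum_prod_type, Finset.sum_sub_distrib, L, R, sub_eq_zero]
    have h2 : ∀ w, ∑ v, ∑ x, 𝒢.adjCoeff x w • q v x = ∑ x, 𝒢.adjCoeff x w • (1 : A) := fun w => by
      rw [Finset.sum_comm]
      simp only [← Finset.smul_sum, hcol]
    have h3 : ∀ v, ∑ w, ∑ x, 𝒢.adjCoeff v x • q x w = ∑ x, 𝒢.adjCoeff v x • (1 : A) := fun v => by
      rw [Finset.sum_comm]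
      simp only [← Finset.smul_sum, hrow]
    rw [Finset.sum_comm]
    simp only [h2, h3]
    exact Finset.sum_comm
  intro v w
  have h4 := sum_eq_zero_of_star_mul_self (fun p : V × V => L p.1 p.2 - R p.1 p.2) hsum (v, w)
  exact sub_eq_zero.1 h4

end Relations

/-! ### The vertex matrix of an object and terminality -/

namespace BanObj

variable {V : Type v} {E : Type w} [Fintype V] [DecidableEq V] [Fintype E] [DecidableEq E]
  {𝒢 : DirectedGraph V E} (X : BanObj.{u} 𝒢)

/-- The matrix of the action on the vertices. -/
noncomputable def vertexMatrix : Matrix V V X.G.alg := Matrix.of fun v w => X.act (Pi.single w 1) v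

theorem vertexMatrix_apply (v w : V) : X.vertexMatrix v w = X.act (Pi.single w 1) v := rfl

theorem act_apply (f : V → ℂ) (v : V) : X.act f v = ∑ w, f w • X.vertexMatrix v w := by
  have h := congrArg (fun F : V → X.G.alg => F v) (congrArg X.act (pi_eq_sum_univ' f))
  simp only [map_sum, map_smul, Finset.sum_apply, Pi.smul_apply] at h
  exact h

theorem edgeAct_apply (ξ : E → ℂ) (e : E) :
    X.edgeAct ξ e = ∑ f, ξ f • X.edgeAct (Pi.single f 1) e := by
  have h := congrArg (fun F : E → X.G.alg => F e) (congrArg X.edgeAct (pi_eq_sum_univ' ξ))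
  simpa only [map_sum, map_smul, Finset.sum_apply, Pi.smul_apply] using h

theorem vertexMatrix_star (v w : V) : star (X.vertexMatrix v w) = X.vertexMatrix v w := by
  have := congrFun (map_star X.act (Pi.single w 1)) v
  rw [Pi.star_apply] at this
  rw [vertexMatrix_apply, ← this, ← Pi.single_star, star_one]

theorem vertexMatrix_mul (v w w' : V) : X.vertexMatrix v w * X.vertexMatrix v w' =
    if w = w' then X.vertexMatrix v w else 0 := by
  have := congrFun (map_mul X.act (Pi.single w 1) (Pi.single w' 1)) v
  rw [vertexMatrix_apply, vertexMatrix_apply, ← Pi.mul_apply, ← this]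
  split_ifs with h
  · subst h
    rw [← Pi.single_mul, one_mul]
  · have h0 : (Pi.single w 1 * Pi.single w' 1 : V → ℂ) = 0 := by
      funext i
      by_cases hi : i = w
      · subst hi; simp [h]
      · simp [hi]
    rw [h0, map_zero, Pi.zero_apply]

theorem vertexMatrix_row (v : V) : ∑ w, X.vertexMatrix v w = 1 := by
  have := X.act_apply 1 v
  rw [map_one] at this
  simpa using this.symm

theorem comul_vertexMatrix (v w : V) : X.G.comul (X.vertexMatrix v w) =
    ∑ x, tmul (X.vertexMatrix v x) (X.vertexMatrix x w) :=
  (X.isGAlgebra.coassoc (Pi.single w 1) v).symm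

/-- Here the Podleś condition enters, through a right inverse of the vertex matrix. -/
theorem vertexMatrix_col (w : V) : ∑ v, X.vertexMatrix v w = 1 := by
  obtain ⟨b, hb⟩ := exists_mul_eq_one_of_dense X.vertexMatrix (by
    have := X.isGAlgebra.podles
    have h : ∀ ξ x, X.act.toAlgHom.toLinearMap ξ x = ∑ w, ξ w • X.vertexMatrix x w :=
      fun ξ x => X.act_apply ξ x
    simpa only [h] using this)
  exact sum_col_eq_one X.G.comul X.vertexMatrix X.vertexMatrix_star X.vertexMatrix_mul
    X.vertexMatrix_row X.comul_vertexMatrix b hb w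

/-- Equivariance of the left action on basis vectors: `φ(δ_x) δ_f` is `δ_f` or zero according to the
source of `f`. -/
theorem vertexMatrix_mul_edgeAct (e f : E) (x : V) :
    X.vertexMatrix (𝒢.s e) x * X.edgeAct (Pi.single f 1) e =
      if 𝒢.s f = x then X.edgeAct (Pi.single f 1) e else 0 := by
  have h := congrFun (X.equivariant.map_leftMul (Pi.single x 1) (Pi.single f 1)) e
  change _ = X.vertexMatrix (𝒢.s e) x * X.edgeAct (Pi.single f 1) e at h
  rw [← h]
  have h1 : 𝒢.leftMul (Pi.single x (1 : ℂ)) (Pi.single f 1) =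
      if 𝒢.s f = x then Pi.single f 1 else 0 := by
    funext g
    by_cases hg : g = f
    · subst hg
      split_ifs with hx <;> simp [leftMul, hx]
    · split_ifs <;> simp [leftMul, Pi.single_apply, hg]
  rw [h1]
  split_ifs
  · rfl
  · rw [map_zero, Pi.zero_apply]

theorem vertexMatrix_range (e : E) (y : V) : X.vertexMatrix (𝒢.r e) y =
    ∑ f with 𝒢.r f = y, X.edgeAct (Pi.single f 1) e := by
  rw [vertexMatrix_apply, X.range_compat, edgeAct_apply, Finset.sum_filter]
  refine Finset.sum_congr rfl fun f _ => ?_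
  simp [Pi.single_apply]

/-- Compatibility with the range map expands the second factor into entries of `λ`; the left action
then selects those with source `x`. -/
theorem vertexMatrix_mul_vertexMatrix (e : E) (x y : V) :
    X.vertexMatrix (𝒢.s e) x * X.vertexMatrix (𝒢.r e) y =
      ∑ f with 𝒢.s f = x ∧ 𝒢.r f = y, X.edgeAct (Pi.single f 1) e := by
  rw [vertexMatrix_range, Finset.mul_sum]
  simp only [vertexMatrix_mul_edgeAct, ← Finset.sum_filter, Finset.filter_filter, and_comm]

/-- At most one edge joins two given vertices. Hence `λ` is determined by `α`, and a morphism need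
only respect the latter. -/
theorem edgeAct_single (h𝒢 : 𝒢.IsSimple) (e f : E) : X.edgeAct (Pi.single f 1) e =
    X.vertexMatrix (𝒢.s e) (𝒢.s f) * X.vertexMatrix (𝒢.r e) (𝒢.r f) := by
  rw [vertexMatrix_mul_vertexMatrix, Finset.sum_eq_single f]
  · intro g hg hne
    obtain ⟨h1, h2⟩ := (Finset.mem_filter.1 hg).2
    exact absurd (h𝒢.no_multiple_edges g f h1 h2) hne
  · intro hf
    exact absurd (Finset.mem_filter.2 ⟨Finset.mem_univ f, rfl, rfl⟩) hf

theorem banicaRelations_vertexMatrix : 𝒢.BanicaRelations X.vertexMatrix := by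
  refine banicaRelations_of_mul_eq_zero _ X.vertexMatrix_star
    (fun v w => by rw [vertexMatrix_mul, if_pos rfl]) X.vertexMatrix_row X.vertexMatrix_col
    fun v z y w h1 h2 => ?_
  rw [adjCoeff] at h1 h2
  obtain ⟨e, rfl, rfl⟩ : ∃ e, 𝒢.s e = v ∧ 𝒢.r e = z := by
    by_contra h
    rw [if_neg h] at h1
    exact zero_ne_one h1
  rw [vertexMatrix_mul_vertexMatrix]
  refine Finset.sum_eq_zero fun f hf => absurd ?_ h2
  exact if_pos ⟨f, (Finset.mem_filter.1 hf).2⟩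

variable {H : CompactQuantumGroup.{u}} {q : Matrix V V H.alg}

/-- A morphism into this object is a homomorphism out of the universal algebra, forced on `q` by
compatibility with `α`. Compatibility with `λ` is automatic because both edge actions are given by
products of vertex entries. -/
theorem isTerminal_ofRelations [Nonempty V] (h𝒢 : 𝒢.IsSimple) (h : 𝒢.BanicaRelations q)
    (hd : Dense (Algebra.adjoin ℂ (Set.range fun p : V × V => q p.1 p.2) : Set H.alg))
    (hlift : ∀ (B : Type u) [CStarAlgebra B] (b : Matrix V V B), 𝒢.BanicaRelations b →
      ∃ f : H.alg →⋆ₐ[ℂ] B, ∀ v w, f (q v w) = b v w)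
    (hΔ : ∀ v w, H.comul (q v w) = ∑ x, tmul (q v x) (q x w)) :
    Nonempty (Limits.IsTerminal (ofRelations h𝒢 h hd hΔ)) := by
  have hex : ∀ X : BanObj.{u} 𝒢, ∃ f : H.alg →⋆ₐ[ℂ] X.G.alg,
      ∀ v w, f (q v w) = X.vertexMatrix v w :=
    fun X => hlift _ _ X.banicaRelations_vertexMatrix
  choose F hF using hex
  refine ⟨Limits.IsTerminal.ofUniqueHom (fun X => (⟨F X, fun a => ?_, fun f v => ?_,
    fun ξ e => ?_⟩ : Hom X (ofRelations h𝒢 h hd hΔ))) fun X m => ?_⟩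
  · refine DFunLike.congr_fun (StarAlgHom.eq_of_dense_adjoin hd
      ((CStarTensor.map (F X) (F X)).comp H.comul) (X.G.comul.comp (F X)) ?_) a
    rintro _ ⟨⟨v, w⟩, rfl⟩
    simp only [StarAlgHom.comp_apply, hΔ, hF, map_sum, map_tmul, comul_vertexMatrix]
  · change F X (h.vertexAction f v) = _
    simp only [h.vertexAction_apply, map_sum, map_smul, hF, X.act_apply]
  · change F X (BanicaRelations.edgeAction 𝒢 q ξ e) = _
    simp only [BanicaRelations.edgeAction_apply, map_sum, map_smul, map_mul, hF,
      X.edgeAct_apply ξ, X.edgeAct_single h𝒢]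
  · refine Hom.ext (StarAlgHom.eq_of_dense_adjoin hd _ _ ?_)
    rintro _ ⟨⟨v, w⟩, rfl⟩
    have h1 := m.map_act (Pi.single w 1) v
    change m.hom (h.vertexAction (Pi.single w 1) v) = X.vertexMatrix v w at h1
    rw [h.vertexAction_single] at h1
    exact h1.trans (hF X v w).symm

end BanObj

end DirectedGraph

theorem CompactQuantumGroup.nonempty_iso_refl (H : CompactQuantumGroup.{u}) :
    Nonempty (CompactQuantumGroup.Iso H H) :=
  ⟨⟨StarAlgEquiv.refl ℂ H.alg, fun a => by
    have : ((StarAlgEquiv.refl ℂ H.alg : H.alg ≃⋆ₐ[ℂ] H.alg) : H.alg →⋆ₐ[ℂ] H.alg) =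
        StarAlgHom.id ℂ H.alg := StarAlgHom.ext fun _ => rfl
    rw [this, map_id]
    rfl⟩⟩

theorem mainTheorem6 {V : Type v} {E : Type w} [Fintype V] [DecidableEq V] [Nonempty V]
    [Fintype E] [DecidableEq E] (𝒢 : DirectedGraph V E) (h𝒢 : 𝒢.IsSimple) :
    ∃ (U : DirectedGraph.BanObj.{u} 𝒢) (H : CompactQuantumGroup.{u}),
      Nonempty (CategoryTheory.Limits.IsTerminal U) ∧ 𝒢.IsAutBan H ∧
        Nonempty (CompactQuantumGroup.Iso U.G H) := by
  obtain ⟨H, q, hq, hd, hlift, hΔ⟩ := 𝒢.exists_compactQuantumGroup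
  -- The quantum group of the universal object is `H` itself, so the isomorphism is the identity.
  refine ⟨DirectedGraph.BanObj.ofRelations h𝒢 hq hd hΔ, H,
    DirectedGraph.BanObj.isTerminal_ofRelations h𝒢 hq hd hlift hΔ, ⟨q, hq, fun B _ b hb => ?_, hΔ⟩,
    H.nonempty_iso_refl⟩
  obtain ⟨f, hf⟩ := hlift B b hb
  refine ⟨f, hf, fun g hg => StarAlgHom.eq_of_dense_adjoin hd g f ?_⟩
  rintro _ ⟨⟨v, w⟩, rfl⟩
  exact (hg v w).trans (hf v w).symm
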